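/- Let $X$ be a finite set and let $X^*$ be the set of finite words over $X$, viewed as a rooted tree; write $u\sqsubseteq v$ if $u$ is a prefix of $v$. Let $\mathrm{Aut}(X^*)$ be the group of bijections $g$ of $X^*$ such that $u\sqsubseteq v$ if and only if $g(u)\sqsubseteq g(v)$. For $g\in\mathrm{Aut}(X^*)$ and $u\in X^*$, the section $\psi_u(g)=g_u\in\mathrm{Aut}(X^*)$ is defined by $g(uw)=g(u)\,g_u(w)$ for all $w\in X^*$. A finite set $Y\subseteq X^*$ is a spanning leaf set if no element of $Y$ is a prefix of another element of $Y$ and there is $N$ such that every word of length at least $N$ has a prefix in $Y$. For $H\leq\mathrm{Aut}(X^*)$, let $\mathrm{st}_H(Y)$ be the pointwise stabilizer of $Y$ in $H$; on it the map $\psi_Y=(\psi_y)_{y\in Y}$ is a homomorphism into $\mathrm{Aut}(X^*)^Y$. For $G,H\leq\mathrm{Aut}(X^*)$, we say that $\mathrm{st}_H(Y)$ is an infra-direct product of $G^Y$ if $\psi_Y(\mathrm{st}_H(Y))\leq G^Y$ and $\psi_y(\mathrm{st}_H(Y))$ has finite index in $G$ for every $y\in Y$. A group $G\leq\mathrm{Aut}(X^*)$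 obeys the Grigorchuk--Nagnibeda alternative if for every finitely generated subgroup $H\leq G$ at least one of the following holds: (a) there is $y\in X^*$ such that $\psi_y(H)=\{h_y : h\in H\}$ is finite; (b) there is a spanning leaf set $Y\subseteq X^*$ such that $\mathrm{st}_H(Y)$ is an infra-direct product of $G^Y$. The Grigorchuk group is the subgroup $\langle a,b,c,d\rangle$ of $\mathrm{Aut}(\{0,1\}^*)$, where $a$ exchanges the first letter, $a(0w)=1w$ and $a(1w)=0w$, and $b,c,d$ fix the first level and have the sections $(b_0,b_1)=(a,c)$, $(c_0,c_1)=(a,d)$, $(d_0,d_1)=(1,b)$. The Gupta--Sidki $3$-group is the subgroup $\langle a,t\rangle$ of $\mathrm{Aut}(\{0,1,2\}^*)$, where $a(xw)=(x+1 \bmod 3)\,w$ and $t$ fixes the first level and has the sections $(t_0,t_1,t_2)=(a,a^{-1},t)$. Theorem. Both the Grigorchuk group and the Gupta--Sidki $3$-group obey the Grigorchuk--Nagnibeda alternative. -/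

import Mathlib

namespace RootedTree

/-- The automorphism group of the rooted tree `X^*`: the bijections `g` of the set of finite words
over `X` such that `u` is a prefix of `v` if and only if `g u` is a prefix of `g v`.
Multiplication is composition: `(g * h) w = g (h w)`. -/
abbrev TreeAut (X : Type*) : Type _ :=
  ((· <+: ·) : List X → List X → Prop) ≃r ((· <+: ·) : List X → List X → Prop)

section Sections

variable {X : Type*}

theorem drop_spec (g : TreeAut X) (u w : List X) :
    g u ++ (g (u ++ w)).drop (g u).length = g (u ++ w) := by
  obtain ⟨v, hv⟩ := g.map_rel_iff.2 (List.prefix_append u w)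
  rw [← hv]; simp

theorem drop_spec_inv (g : TreeAut X) (u w : List X) :
    u ++ (g⁻¹ (g u ++ w)).drop u.length = g⁻¹ (g u ++ w) := by
  have h := drop_spec g⁻¹ (g u) w
  rwa [RelIso.inv_apply_self] at h

/-- The section `g_u` of `g` at the word `u`: the automorphism determined by
`g (u ++ w) = g u ++ g_u w` for all words `w`. -/
def sec (u : List X) (g : TreeAut X) : TreeAut X where
  toFun w := (g (u ++ w)).drop (g u).length
  invFun w := (g⁻¹ (g u ++ w)).drop u.length
  left_inv w := by
    dsimp only
    rw [drop_spec, RelIso.inv_apply_self]; simp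
  right_inv w := by
    dsimp only
    rw [drop_spec_inv, RelIso.apply_inv_self]; simp
  map_rel_iff' := by
    intro v w
    change (g (u ++ v)).drop (g u).length <+: (g (u ++ w)).drop (g u).length ↔ _
    rw [← List.prefix_append_right_inj (g u), drop_spec, drop_spec, g.map_rel_iff,
      List.prefix_append_right_inj]

/-- The defining property of sections. -/
theorem apply_append (g : TreeAut X) (u w : List X) : g (u ++ w) = g u ++ sec u g w :=
  (drop_spec g u w).symm

theorem sec_one (u : List X) : sec u (1 : TreeAut X) = 1 := by
  ext1 w
  apply List.append_cancel_left (as := (1 : TreeAut X) u)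
  rw [← apply_append]; rfl

theorem sec_mul (u : List X) (g h : TreeAut X) : sec u (g * h) = sec (h u) g * sec u h := by
  ext1 w
  apply List.append_cancel_left (as := (g * h) u)
  rw [← apply_append, RelIso.mul_apply, RelIso.mul_apply, RelIso.mul_apply, apply_append,
    apply_append]

/-- `st_H(Y)`: the pointwise stabilizer in `H` of a set `Y` of words. -/
def st (H : Subgroup (TreeAut X)) (Y : Set (List X)) : Subgroup (TreeAut X) where
  carrier := {g | g ∈ H ∧ ∀ y ∈ Y, g y = y}
  one_mem' := ⟨H.one_mem, fun _ _ => rfl⟩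
  mul_mem' := by
    rintro g h ⟨hg, hg'⟩ ⟨hh, hh'⟩
    exact ⟨H.mul_mem hg hh, fun y hy => by rw [RelIso.mul_apply, hh' y hy, hg' y hy]⟩
  inv_mem' := by
    rintro g ⟨hg, hg'⟩
    refine ⟨H.inv_mem hg, fun y hy => ?_⟩
    conv_lhs => rw [← hg' y hy]
    exact RelIso.inv_apply_self g y

/-- The homomorphism `ψ_Y : g ↦ (g_y)_{y ∈ Y}` on the pointwise stabilizer of `Y` in `H`. -/
def secHom (H : Subgroup (TreeAut X)) (Y : Set (List X)) : st H Y →* (Y → TreeAut X) where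
  toFun g := fun y => sec (y : List X) (g : TreeAut X)
  map_one' := by funext y; exact sec_one _
  map_mul' g h := by
    funext y
    change sec (y : List X) ((g : TreeAut X) * h) = sec (y : List X) g * sec (y : List X) h
    rw [sec_mul, h.2.2 y y.2]

/-- A leaf set is a finite set of words that are pairwise not prefixes of each other. -/
def IsLeafSet (Y : Set (List X)) : Prop :=
  Y.Finite ∧ ∀ x ∈ Y, ∀ y ∈ Y, x ≠ y → ¬ x <+: y

/-- A leaf set is spanning if all sufficiently long words have a prefix in it. -/
def IsSpanningLeafSet (Y : Set (List X)) : Prop :=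
  IsLeafSet Y ∧ ∃ N : ℕ, ∀ x : List X, N ≤ x.length → ∃ y ∈ Y, y <+: x

/-- For a subgroup `G` of a group `A` and an index set `Y`, the subgroup `L` of `A ^ Y` is an
infra-direct product of `G ^ Y` if it is contained in `G ^ Y` and each of its coordinate
projections is of finite index in `G`. -/
def IsInfraDirectProduct {A Y : Type*} [Group A] (G : Subgroup A) (L : Subgroup (Y → A)) : Prop :=
  L ≤ Subgroup.pi Set.univ (fun _ : Y => G) ∧
    ∀ y : Y, (L.map (Pi.evalMonoidHom (fun _ : Y => A) y)).IsFiniteRelIndex G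

/-- The Grigorchuk--Nagnibeda alternative for a subgroup `G` of the automorphism group of the
tree `X^*`. -/
def ObeysGNAlternative (G : Subgroup (TreeAut X)) : Prop :=
  ∀ H : Subgroup (TreeAut X), H ≤ G → H.FG →
    (∃ y : List X, (sec y '' (H : Set (TreeAut X))).Finite) ∨
    (∃ Y : Set (List X), IsSpanningLeafSet Y ∧ IsInfraDirectProduct G (secHom H Y).range)

end Sections

section Automata

variable {S X : Type*}

/-- The word transformation computed from the state `s` by the letter-to-letter automaton which
in the state `s` replaces a letter `x` by `out s x` and passes to the state `next s x`. -/
def run (out : S → Equiv.Perm X) (next : S → X → S) : S → List X → List X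
  | _, [] => []
  | s, x :: w => out s x :: run out next (next s x) w

/-- The inverse transformation of `run`. -/
def runInv (out : S → Equiv.Perm X) (next : S → X → S) : S → List X → List X
  | _, [] => []
  | s, x :: w => (out s).symm x :: runInv out next (next s ((out s).symm x)) w

/-- The tree automorphism defined by the state `s` of an automaton: it acts on the first level by
the permutation `out s`, and its section at the letter `x` is the automorphism defined by the
state `next s x`. -/
def autOf (out : S → Equiv.Perm X) (next : S → X → S) (s : S) : TreeAut X where
  toFun := run out next s
  invFun := runInv out next s
  left_inv w := by
    induction w generalizing s with
    | nil => rfl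
    | cons x w ih => simp [run, runInv, ih]
  right_inv w := by
    induction w generalizing s with
    | nil => rfl
    | cons x w ih => simp [run, runInv, ih]
  map_rel_iff' := by
    intro v w
    change run out next s v <+: run out next s w ↔ _
    induction v generalizing s w with
    | nil => simp [run]
    | cons x v ih =>
      cases w with
      | nil => simp [run]
      | cons y w =>
        simp only [run, List.cons_prefix_cons, EmbeddingLike.apply_eq_iff_eq]
        constructor
        · rintro ⟨rfl, h⟩
          exact ⟨rfl, (ih _).1 h⟩
        · rintro ⟨rfl, h⟩
          exact ⟨rfl, (ih _).2 h⟩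

end Automata

section Grigorchuk

inductive GrigState
  | e | a | b | c | d

def grigOut : GrigState → Equiv.Perm (Fin 2)
  | .a => Equiv.swap 0 1
  | _ => 1

def grigNext : GrigState → Fin 2 → GrigState
  | .e, _ => .e
  | .a, _ => .e
  | .b, 0 => .a
  | .b, 1 => .c
  | .c, 0 => .a
  | .c, 1 => .d
  | .d, 0 => .e
  | .d, 1 => .b

/-- The generators of the Grigorchuk group: `a` exchanges the two subtrees below the root, and
`b = (a, c)`, `c = (a, d)`, `d = (1, b)`; the state `e` gives the identity. -/
def grigGen (s : GrigState) : TreeAut (Fin 2) := autOf grigOut grigNext s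

/-- The (first) Grigorchuk group. -/
def grigorchukGroup : Subgroup (TreeAut (Fin 2)) :=
  Subgroup.closure {grigGen .a, grigGen .b, grigGen .c, grigGen .d}

end Grigorchuk

section GuptaSidki

/-- The states: the identity, `a`, the inverse of `a`, and `t`. -/
inductive GSState
  | e | a | aInv | t

def gsOut : GSState → Equiv.Perm (Fin 3)
  | .a => finRotate 3
  | .aInv => (finRotate 3)⁻¹
  | _ => 1

def gsNext : GSState → Fin 3 → GSState
  | .t, 0 => .a
  | .t, 1 => .aInv
  | .t, 2 => .t
  | _, _ => .e

/-- The generators of the Gupta--Sidki 3-group: `a` permutes the three subtrees below the root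
cyclically, and `t = (a, a⁻¹, t)`. -/
def gsGen (s : GSState) : TreeAut (Fin 3) := autOf gsOut gsNext s

/-- The Gupta--Sidki 3-group. -/
def guptaSidkiGroup : Subgroup (TreeAut (Fin 3)) :=
  Subgroup.closure {gsGen .a, gsGen .t}

end GuptaSidki

end RootedTree

/-!
Both groups are treated by the same induction. For a group `K` of tree automorphisms let
`secGroup v K` consist of the sections at `v` of the elements of `K` that fix `v`. It is enough to
show that every finitely generated `H ≤ G` *settles* (`Settles`): at all sufficiently deep vertices
`v` the group `secGroup v H` is finite or contains `G`. For if `secGroup v H` is finite, so is the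
set of all sections of `H` at `v`, since the orbit of `v` is finite; and if no section group is
finite, the words of a fixed large length form a spanning leaf set, and passing to the pointwise
stabilizer of this level costs only a finite index (`ObeysGNAlternative.of_settles`).

Each of the two groups is generated by a cyclic group `A` of rooted automorphisms and a finite group
`B` of directed automorphisms, whose sections lie in `B` at one letter `x₀` and in `A` at the other
letters (`Frame`). Realize `H` as the stabilizer of a point `y` of a transitive action. Elements of
`H` are closed walks from `y`, with steps in `A` and in `B`; as `H` is finitely generated, a finite
set `T` of points is enough to accommodate all endpoints of `B`-steps (`Carried`). The section group
of `H` at a letter is again a stabilizer, now of a point of its own coset space. A pair of a letter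
`x` and a point `z` descends to at most one point there (`Lift`), and `B`-steps survive only at the
letter `x₀`. Hence the stabilizer is carried by the descendants of `T` from `x₀`, so that the number
of points never grows (`Frame.Carried.next`), and one argues by induction on this number
(`Frame.settles_of_fg`). If `H` fixes the letters, the number drops or `H` is finite
(`Frame.settles_of_fixes_level`). If `H` moves the letters, it may be assumed that the points of `T`
have different descendants (`Frame.settles_of_injOn`).

*Grigorchuk group.* A point of `T` whose rotation does not lie in `T` can be left out
(`settles_of_not_invariant`). If `T` contains `w` and `d w ≠ w`, then the rotations of both points
have the same descendant, since `d` has the trivial section at `0`. A pair of different points in an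
orbit of `c` or `b` descends to one in an orbit of `d` or `c`, so that all pairs are excluded
(`pairSettles`). What remains are groups generated by `a` and a subgroup of `{1, b, c, d}`. Such a
group is finite dihedral or the whole group.

*Gupta–Sidki group.* The `flow` of a function with values in `ZMod 3` along a walk is its total
change along the `B`-steps. A closed walk with a nonzero flow has, possibly after taking its cube, a
section with a nonzero flow and fewer `B`-steps; so there are no such walks once the number of
points is stable (`settles_of_flow`). Coordinates on free orbits of `A` or `B` produce nonzero flows
(`wexp_add_flow`, `settles_of_iB_free`). Otherwise there are a point fixed by `A` and a point fixed
by `B`. If they are equal, the stabilizer is the whole group; if they are different, there are two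
different points fixed by `A` at the next level (`settles_of_fixed_fixed`), and comparing the
sections of a walk between these yields a nonzero flow (`settles_of_two_fixed`).
-/

namespace RootedTree

/-! ### Tree automorphisms: levels, sections and section groups -/

section Basics

variable {X : Type*}

theorem apply_nil (g : TreeAut X) : g [] = [] := by
  have h : g [] <+: g (g⁻¹ []) := g.map_rel_iff.2 List.nil_prefix
  rw [RelIso.apply_inv_self] at h
  exact List.prefix_nil.1 h

theorem exists_apply_singleton (g : TreeAut X) (x : X) : ∃ x', g [x] = [x'] := by
  rcases h : g [x] with _ | ⟨p, l⟩
  · rw [← apply_nil g] at h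
    simpa using g.injective h
  · have h1 : g (g⁻¹ [p]) <+: g [x] := by
      rw [RelIso.apply_inv_self, h]
      simp
    have h2 := g.map_rel_iff.1 h1
    rcases h3 : g⁻¹ [p] with _ | ⟨q, m⟩
    · have := congrArg g h3
      rw [RelIso.apply_inv_self, apply_nil] at this
      simp at this
    · rw [h3] at h2
      obtain ⟨rfl, h4⟩ := List.cons_prefix_cons.1 h2
      obtain rfl := List.prefix_nil.1 h4
      exact ⟨p, by rw [← h, ← h3, RelIso.apply_inv_self]⟩

theorem length_apply (g : TreeAut X) (u : List X) : (g u).length = u.length := by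
  induction u generalizing g with
  | nil => simp [apply_nil]
  | cons x u ih =>
    obtain ⟨x', hx'⟩ := exists_apply_singleton g x
    rw [← List.singleton_append, apply_append, hx', List.length_append, ih, List.length_append]
    rfl

theorem sec_nil (g : TreeAut X) : sec [] g = g := by
  ext1 w
  have h := apply_append g [] w
  rw [apply_nil] at h
  exact h.symm

theorem sec_append (u v : List X) (g : TreeAut X) : sec (u ++ v) g = sec v (sec u g) := by
  ext1 w
  apply List.append_cancel_left (as := g (u ++ v))
  rw [← apply_append, List.append_assoc, apply_append g u, apply_append (sec u g) v,
    apply_append g u v, List.append_assoc]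

theorem sec_inv (u : List X) (g : TreeAut X) : sec u g⁻¹ = (sec (g⁻¹ u) g)⁻¹ := by
  have h := sec_mul u g g⁻¹
  rw [mul_inv_cancel, sec_one] at h
  exact (inv_eq_of_mul_eq_one_right h.symm).symm

theorem sec_pow_of_apply_eq {u : List X} {g : TreeAut X} (h : g u = u) (n : ℕ) :
    sec u (g ^ n) = sec u g ^ n := by
  induction n with
  | zero => exact sec_one u
  | succ n ih => rw [pow_succ, pow_succ, sec_mul, h, ih]

theorem pow_apply_of_apply_eq {u : List X} {g : TreeAut X} (h : g u = u) (n : ℕ) :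
    (g ^ n) u = u := by
  induction n with
  | zero => rfl
  | succ n ih => rw [pow_succ, RelIso.mul_apply, h, ih]

/-- An automorphism that fixes the first level and has trivial sections there is trivial. -/
theorem eq_one_of_sec {g : TreeAut X} (h : ∀ x, g [x] = [x]) (h' : ∀ x, sec [x] g = 1) :
    g = 1 := by
  ext1 w
  cases w with
  | nil => exact apply_nil g
  | cons x w => rw [← List.singleton_append, apply_append, h, h']; rfl

/-- The group of the sections at `u` of the elements of `K` that fix `u`. -/
def secGroup (u : List X) (K : Subgroup (TreeAut X)) : Subgroup (TreeAut X) where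
  carrier := {s | ∃ g ∈ K, g u = u ∧ sec u g = s}
  one_mem' := ⟨1, K.one_mem, rfl, sec_one u⟩
  mul_mem' := by
    rintro _ _ ⟨g, hg, hgu, rfl⟩ ⟨h, hh, hhu, rfl⟩
    exact ⟨g * h, K.mul_mem hg hh, by rw [RelIso.mul_apply, hhu, hgu], by rw [sec_mul, hhu]⟩
  inv_mem' := by
    rintro _ ⟨g, hg, hgu, rfl⟩
    have h : g⁻¹ u = u := by
      conv_lhs => rw [← hgu]
      exact RelIso.inv_apply_self g u
    exact ⟨g⁻¹, K.inv_mem hg, h, by rw [sec_inv, h]⟩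

theorem secGroup_mono {u : List X} {K L : Subgroup (TreeAut X)} (h : K ≤ L) :
    secGroup u K ≤ secGroup u L := by
  rintro _ ⟨g, hg, hgu, rfl⟩
  exact ⟨g, h hg, hgu, rfl⟩

theorem secGroup_append (u v : List X) (K : Subgroup (TreeAut X)) :
    secGroup (u ++ v) K = secGroup v (secGroup u K) := by
  ext s
  constructor
  · rintro ⟨g, hg, hguv, rfl⟩
    rw [apply_append] at hguv
    obtain ⟨h1, h2⟩ := List.append_inj hguv (length_apply g u)
    exact ⟨sec u g, ⟨g, hg, h1, rfl⟩, h2, (sec_append u v g).symm⟩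
  · rintro ⟨_, ⟨g, hg, h1, rfl⟩, h2, rfl⟩
    exact ⟨g, hg, by rw [apply_append, h1, h2], sec_append u v g⟩

theorem secGroup_nil (K : Subgroup (TreeAut X)) : secGroup [] K = K := by
  ext s
  constructor
  · rintro ⟨g, hg, -, rfl⟩
    rwa [sec_nil]
  · intro hs
    exact ⟨s, hs, apply_nil s, sec_nil s⟩

theorem finite_secGroup {u : List X} {K : Subgroup (TreeAut X)}
    (h : (K : Set (TreeAut X)).Finite) : (secGroup u K : Set (TreeAut X)).Finite :=
  (h.image (sec u)).subset (by rintro _ ⟨g, hg, -, rfl⟩; exact ⟨g, hg, rfl⟩)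

theorem sec_mem_of_sec_singleton_mem {G : Subgroup (TreeAut X)}
    (hG : ∀ g ∈ G, ∀ x : X, sec [x] g ∈ G) {g : TreeAut X} (hg : g ∈ G) (u : List X) :
    sec u g ∈ G := by
  induction u generalizing g with
  | nil => rwa [sec_nil]
  | cons x u ih =>
    rw [← List.singleton_append, sec_append]
    exact ih (hG g hg x)

theorem le_secGroup {G : Subgroup (TreeAut X)} (hG : ∀ x : X, G ≤ secGroup [x] G) (u : List X) :
    G ≤ secGroup u G := by
  induction u with
  | nil => rw [secGroup_nil]
  | cons x u ih =>
    rw [← List.singleton_append, secGroup_append]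
    exact ih.trans (secGroup_mono (hG x))

end Basics

/-! ### Groups whose sections settle -/

section Settling

variable {X : Type*}

/-- `Settles G K`: at all sufficiently deep vertices the section group of `K` is finite or contains
the whole of `G`. -/
def Settles (G K : Subgroup (TreeAut X)) : Prop :=
  ∃ N : ℕ, ∀ v : List X, N ≤ v.length →
    (secGroup v K : Set (TreeAut X)).Finite ∨ G ≤ secGroup v K

theorem Settles.of_finite {G K : Subgroup (TreeAut X)} (h : (K : Set (TreeAut X)).Finite) :
    Settles G K :=
  ⟨0, fun _ _ => Or.inl (finite_secGroup h)⟩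

theorem Settles.of_le {G K : Subgroup (TreeAut X)} (hG : ∀ x : X, G ≤ secGroup [x] G)
    (h : G ≤ K) : Settles G K :=
  ⟨0, fun v _ => Or.inr ((le_secGroup hG v).trans (secGroup_mono h))⟩

theorem Settles.of_sec [Finite X] {G K : Subgroup (TreeAut X)}
    (h : ∀ x : X, Settles G (secGroup [x] K)) : Settles G K := by
  choose N hN using h
  obtain ⟨M, hM⟩ := (Set.finite_range N).bddAbove
  refine ⟨M + 1, fun v hv => ?_⟩
  cases v with
  | nil => simp at hv
  | cons x v =>
    rw [← List.singleton_append, secGroup_append]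
    apply hN x v
    have := hM (Set.mem_range_self x)
    simp only [List.length_cons] at hv
    omega

theorem Settles.of_conj {G K L : Subgroup (TreeAut X)} (hG : ∀ g ∈ G, ∀ x : X, sec [x] g ∈ G)
    {g : TreeAut X} (hg : g ∈ G) (hKL : ∀ k ∈ K, g * k * g⁻¹ ∈ L)
    (hLK : ∀ l ∈ L, g⁻¹ * l * g ∈ K) (h : Settles G K) : Settles G L := by
  obtain ⟨N, hN⟩ := h
  refine ⟨N, fun v hv => ?_⟩
  set u := g⁻¹ v with hu
  have hgu : g u = v := RelIso.apply_inv_self g v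
  set s := sec u g with hs
  have hsG : s ∈ G := sec_mem_of_sec_singleton_mem hG hg u
  have hsinv : sec v g⁻¹ = s⁻¹ := sec_inv v g
  have hul : N ≤ u.length := by rwa [hu, length_apply]
  have h1 : ∀ k ∈ secGroup u K, s * k * s⁻¹ ∈ secGroup v L := by
    rintro _ ⟨k, hk, hku, rfl⟩
    refine ⟨g * k * g⁻¹, hKL k hk, ?_, ?_⟩
    · rw [RelIso.mul_apply, RelIso.mul_apply, ← hu, hku, hgu]
    · rw [sec_mul, sec_mul, hsinv, ← hu, hku]
  have h2 : ∀ l ∈ secGroup v L, s⁻¹ * l * s ∈ secGroup u K := by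
    rintro _ ⟨l, hl, hlv, rfl⟩
    refine ⟨g⁻¹ * l * g, hLK l hl, ?_, ?_⟩
    · rw [RelIso.mul_apply, RelIso.mul_apply, hgu, hlv]
    · rw [sec_mul, sec_mul, hgu, hlv, hsinv]
  rcases hN u hul with hfin | hle
  · left
    refine (hfin.image (fun k => s * k * s⁻¹)).subset fun l hl => ⟨_, h2 l hl, ?_⟩
    group
  · right
    intro q hq
    have := h1 _ (hle (G.mul_mem (G.mul_mem (G.inv_mem hsG) hq) hsG))
    convert this using 1
    group

/-- If the section group of `H` at `v` is finite, so is the set of all sections of `H` at `v`,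
because `v` has a finite orbit. -/
theorem finite_image_sec [Finite X] {H : Subgroup (TreeAut X)} {v : List X}
    (h : (secGroup v H : Set (TreeAut X)).Finite) : (sec v '' (H : Set (TreeAut X))).Finite := by
  classical
  let r : List X → TreeAut X := fun u => if h : ∃ g ∈ H, g v = u then h.choose else 1
  have hO : {u : List X | u.length = v.length}.Finite := List.finite_length_eq X v.length
  refine (Set.Finite.image2 (· * ·) (hO.image fun u => sec v (r u)) h).subset ?_
  rintro _ ⟨g, hg, rfl⟩
  have hex : ∃ k ∈ H, k v = g v := ⟨g, hg, rfl⟩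
  have hr : r (g v) = hex.choose := dif_pos hex
  obtain ⟨hrH, hrv⟩ := hex.choose_spec
  rw [← hr] at hrH hrv
  have hfix : ((r (g v))⁻¹ * g) v = v := by
    apply (r (g v)).injective
    rw [RelIso.mul_apply, RelIso.apply_inv_self, hrv]
  refine ⟨_, ⟨g v, length_apply g v, rfl⟩, _, ⟨(r (g v))⁻¹ * g,
    H.mul_mem (H.inv_mem hrH) hg, hfix, rfl⟩, ?_⟩
  change sec v (r (g v)) * sec v ((r (g v))⁻¹ * g) = sec v g
  have hg' := sec_mul v (r (g v)) ((r (g v))⁻¹ * g)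
  rw [hfix, mul_inv_cancel_left] at hg'
  exact hg'.symm

/-- The pointwise stabilizer of a level has finite index. -/
theorem finiteIndex_st_top [Finite X] (N : ℕ) :
    (st (⊤ : Subgroup (TreeAut X)) {w | w.length = N}).FiniteIndex := by
  let Y := {w : List X // w.length = N}
  have : Finite Y := (List.finite_length_eq X N).to_subtype
  let f : TreeAut X →* Equiv.Perm Y :=
    { toFun := fun g =>
        { toFun := fun w => ⟨g w.1, (length_apply g w.1).trans w.2⟩
          invFun := fun w => ⟨g⁻¹ w.1, (length_apply g⁻¹ w.1).trans w.2⟩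
          left_inv := fun w => Subtype.ext (RelIso.inv_apply_self g w.1)
          right_inv := fun w => Subtype.ext (RelIso.apply_inv_self g w.1) }
      map_one' := rfl
      map_mul' := fun _ _ => rfl }
  have hker : f.ker ≤ st (⊤ : Subgroup (TreeAut X)) {w | w.length = N} := fun g hg =>
    ⟨trivial, fun w hw => congrArg Subtype.val (Equiv.congr_fun (MonoidHom.mem_ker.1 hg) ⟨w, hw⟩)⟩
  exact Subgroup.finiteIndex_of_le hker

/-- Pass from `H ∩ st v` to the stabilizer of the whole level: this is a subgroup of finite index,
so that its image under `sec v` has finite index in a group that contains `G`. -/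
theorem isInfraDirectProduct_level [Finite X] {G H : Subgroup (TreeAut X)}
    (hG : ∀ g ∈ G, ∀ x : X, sec [x] g ∈ G) (hH : H ≤ G) {N : ℕ}
    (h : ∀ v : List X, v.length = N → G ≤ secGroup v H) :
    IsInfraDirectProduct G (secHom H {w : List X | w.length = N}).range := by
  constructor
  · rintro _ ⟨g, rfl⟩ y -
    exact sec_mem_of_sec_singleton_mem hG (hH g.2.1) _
  · rintro ⟨y, hy⟩
    let φ : st H {y} →* TreeAut X :=
      { toFun := fun g => sec y g.1
        map_one' := sec_one y
        map_mul' := fun a b => by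
          change sec y (a.1 * b.1) = _
          rw [sec_mul, b.2.2 y rfl] }
    let L := st (⊤ : Subgroup (TreeAut X)) {w : List X | w.length = N}
    have : L.FiniteIndex := finiteIndex_st_top N
    have hfin : (L.subgroupOf (st H {y})).FiniteIndex := inferInstance
    have hrel : ((L.subgroupOf (st H {y})).map φ).IsFiniteRelIndex ((⊤ : Subgroup _).map φ) := by
      rw [Subgroup.isFiniteRelIndex_iff_relIndex_ne_zero, Subgroup.relIndex_map_map, top_sup_eq,
        Subgroup.relIndex_top_right]
      exact (Subgroup.finiteIndex_of_le (le_sup_left (a := L.subgroupOf (st H {y})))).index_ne_zero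
    have h1 : G ≤ (⊤ : Subgroup (st H {y})).map φ := by
      intro s hs
      obtain ⟨g, hg, hgy, rfl⟩ := h y hy hs
      exact ⟨⟨g, hg, by rintro _ rfl; exact hgy⟩, trivial, rfl⟩
    have h2 : (L.subgroupOf (st H {y})).map φ ≤
        (secHom H {w : List X | w.length = N}).range.map
          (Pi.evalMonoidHom (fun _ : {w : List X | w.length = N} => TreeAut X) ⟨y, hy⟩) := by
      rintro _ ⟨g, hg, rfl⟩
      exact ⟨_, ⟨⟨g.1, g.2.1, (Subgroup.mem_subgroupOf.1 hg).2⟩, rfl⟩, rfl⟩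
    have := Subgroup.isFiniteRelIndex_of_le_right ((L.subgroupOf (st H {y})).map φ) h1
    exact Subgroup.isFiniteRelIndex_of_le_left _ h2

/-- If some section group of `H` is finite, so is the set of the sections of `H` at that vertex.
If no section group of `H` is finite, the words of a sufficiently large length form the required
spanning leaf set. -/
theorem ObeysGNAlternative.of_settles [Finite X] {G : Subgroup (TreeAut X)}
    (hG : ∀ g ∈ G, ∀ x : X, sec [x] g ∈ G)
    (h : ∀ H : Subgroup (TreeAut X), H ≤ G → H.FG → Settles G H) : ObeysGNAlternative G := by
  intro H hH hfg
  obtain ⟨N, hN⟩ := h H hH hfg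
  by_cases hex : ∃ v : List X, (secGroup v H : Set (TreeAut X)).Finite
  · obtain ⟨v, hv⟩ := hex
    exact Or.inl ⟨v, finite_image_sec hv⟩
  · push Not at hex
    refine Or.inr ⟨{w | w.length = N}, ⟨⟨List.finite_length_eq X N, ?_⟩, N, fun w hw => ?_⟩, ?_⟩
    · intro u hu v hv huv hpre
      exact huv (hpre.eq_of_length (hu.trans hv.symm))
    · exact ⟨w.take N, by simpa using hw, List.take_prefix N w⟩
    · exact isInfraDirectProduct_level hG hH fun v hv =>
        (hN v hv.ge).resolve_left (hex v)

end Settling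

/-! ### Self-similar groups generated by rooted and directed automorphisms -/

/-- The common shape of the two groups: a group `A` of rooted automorphisms, which act regularly
on the letters and have trivial sections, and a group `B` of automorphisms which fix the letters
and whose sections lie in `B` at the letter `x₀` and in `A` at the other letters. -/
structure Frame (X A B : Type) [CommGroup A] [Group B] where
  /-- The action of `A` on the letters. -/
  perm : A →* Equiv.Perm X
  perm_free : ∀ α x, perm α x = x → α = 1
  perm_trans : ∀ x x', ∃ α, perm α x = x'
  /-- The rooted automorphisms. Injectivity is not part of the structure. -/
  iA : A →* TreeAut X
  /-- The directed automorphisms. -/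
  iB : B →* TreeAut X
  /-- The letter at which the sections of `B` lie in `B`. -/
  x₀ : X
  /-- The section of an element of `B` at `x₀`. -/
  σ : B → B
  /-- The sections of an element of `B` at the other letters; the value at `x₀` plays no role. -/
  ρ : X → B → A
  iA_apply : ∀ α x, iA α [x] = [perm α x]
  sec_iA : ∀ α x, sec [x] (iA α) = 1
  iB_apply : ∀ β x, iB β [x] = [x]
  sec_iB_base : ∀ β, sec [x₀] (iB β) = iB (σ β)
  sec_iB : ∀ β x, x ≠ x₀ → sec [x] (iB β) = iA (ρ x β)

namespace Frame

variable {X A B : Type} [CommGroup A] [Group B] (D : Frame X A B)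

theorem perm_eq_iff {α α' : A} {x : X} : D.perm α x = D.perm α' x ↔ α = α' := by
  refine ⟨fun h => ?_, fun h => by rw [h]⟩
  have : D.perm (α'⁻¹ * α) x = x := by
    rw [map_mul, Equiv.Perm.mul_apply, h, ← Equiv.Perm.mul_apply, ← map_mul, inv_mul_cancel,
      map_one, Equiv.Perm.one_apply]
  exact (inv_mul_eq_one.1 (D.perm_free _ _ this)).symm

/-- The group generated by `A` and `B`. -/
def group : Subgroup (TreeAut X) := D.iA.range ⊔ D.iB.range

/-- The automorphism given by a letter of the alphabet `A ⊕ B`. -/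
def el : A ⊕ B → TreeAut X := Sum.elim D.iA D.iB

/-- The effect of a letter of the alphabet `A ⊕ B` on the first level. -/
def lact : A ⊕ B → X → X
  | .inl α, x => D.perm α x
  | .inr _, x => x

/-- The automorphism given by a word over `A ⊕ B`; the head of the list acts first. -/
def ev : List (A ⊕ B) → TreeAut X
  | [] => 1
  | s :: l => ev l * D.el s

/-- The product of the `A`-letters of a word: its effect on the first level. -/
def wexp : List (A ⊕ B) → A
  | [] => 1
  | .inl α :: l => α * wexp l
  | .inr _ :: l => wexp l

open Classical in
/-- The section of a letter of the alphabet `A ⊕ B` at `x`, as a letter again. -/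
noncomputable def letterSec (x : X) : A ⊕ B → A ⊕ B
  | .inl _ => .inl 1
  | .inr β => if x = D.x₀ then .inr (D.σ β) else .inl (D.ρ x β)

/-- The section of a word at the letter `x`, computed letter by letter. -/
noncomputable def wsec : X → List (A ⊕ B) → List (A ⊕ B)
  | _, [] => []
  | x, s :: l => D.letterSec x s :: wsec (D.lact s x) l

@[simp] theorem el_inl (α : A) : D.el (.inl α) = D.iA α := rfl

@[simp] theorem el_inr (β : B) : D.el (.inr β) = D.iB β := rfl

theorem el_mem (s : A ⊕ B) : D.el s ∈ D.group := by
  cases s with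
  | inl α => exact Subgroup.mem_sup_left ⟨α, rfl⟩
  | inr β => exact Subgroup.mem_sup_right ⟨β, rfl⟩

theorem ev_mem (l : List (A ⊕ B)) : D.ev l ∈ D.group := by
  induction l with
  | nil => exact D.group.one_mem
  | cons s l ih => exact D.group.mul_mem ih (D.el_mem s)

theorem ev_append (l l' : List (A ⊕ B)) : D.ev (l ++ l') = D.ev l' * D.ev l := by
  induction l with
  | nil => simp [ev]
  | cons s l ih => simp [ev, ih, mul_assoc]

omit [Group B] in
theorem wexp_append (l l' : List (A ⊕ B)) : wexp (l ++ l') = wexp l * wexp l' := by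
  induction l with
  | nil => simp [wexp]
  | cons s l ih => cases s <;> simp [wexp, ih, mul_assoc]

theorem el_apply (s : A ⊕ B) (x : X) : D.el s [x] = [D.lact s x] := by
  cases s with
  | inl α => exact D.iA_apply α x
  | inr β => exact D.iB_apply β x

theorem sec_el (s : A ⊕ B) (x : X) :
    sec [x] (D.el s) = D.el (D.letterSec x s) := by
  cases s with
  | inl α => simp [letterSec, D.sec_iA]
  | inr β =>
    by_cases h : x = D.x₀
    · subst h
      simp [letterSec, D.sec_iB_base]
    · simp [letterSec, h, D.sec_iB]

theorem ev_apply (l : List (A ⊕ B)) (x : X) : D.ev l [x] = [D.perm (wexp l) x] := by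
  induction l generalizing x with
  | nil => simp [ev, wexp]
  | cons s l ih =>
    rw [ev, RelIso.mul_apply, el_apply, ih]
    cases s with
    | inl α => rw [wexp, mul_comm, map_mul, Equiv.Perm.mul_apply, lact]
    | inr β => rfl

theorem sec_ev (l : List (A ⊕ B)) (x : X) :
    sec [x] (D.ev l) = D.ev (D.wsec x l) := by
  induction l generalizing x with
  | nil => simp [ev, wsec, sec_one]
  | cons s l ih => rw [ev, sec_mul, el_apply, ih, sec_el, wsec, ev]

/-- The formal inverse of a word. -/
def winv (l : List (A ⊕ B)) : List (A ⊕ B) := (l.map (Sum.map (·⁻¹) (·⁻¹))).reverse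

theorem winv_cons (s : A ⊕ B) (l : List (A ⊕ B)) :
    winv (s :: l) = winv l ++ [Sum.map (·⁻¹) (·⁻¹) s] := by
  simp [winv]

theorem el_inv (s : A ⊕ B) : D.el (Sum.map (·⁻¹) (·⁻¹) s) = (D.el s)⁻¹ := by
  cases s <;> simp [el]

theorem ev_winv (l : List (A ⊕ B)) : D.ev (winv l) = (D.ev l)⁻¹ := by
  induction l with
  | nil => simp [winv, ev]
  | cons s l ih => rw [winv_cons, ev_append, ih]; simp [ev, el_inv]

theorem exists_ev_eq {g : TreeAut X} (hg : g ∈ D.group) : ∃ l, D.ev l = g := by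
  rw [group, Subgroup.sup_eq_closure_mul] at hg
  induction hg using Subgroup.closure_induction with
  | mem g h =>
    obtain ⟨_, ⟨α, rfl⟩, _, ⟨β, rfl⟩, rfl⟩ := h
    exact ⟨[.inr β, .inl α], by simp [ev]⟩
  | one => exact ⟨[], rfl⟩
  | mul g h _ _ ihg ihh =>
    obtain ⟨l, rfl⟩ := ihg
    obtain ⟨l', rfl⟩ := ihh
    exact ⟨l' ++ l, D.ev_append _ _⟩
  | inv g _ ih =>
    obtain ⟨l, rfl⟩ := ih
    exact ⟨winv l, D.ev_winv l⟩

theorem sec_mem {g : TreeAut X} (hg : g ∈ D.group) (x : X) : sec [x] g ∈ D.group := by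
  obtain ⟨l, rfl⟩ := D.exists_ev_eq hg
  rw [sec_ev]
  exact D.ev_mem _

/-- Conjugating by a rotation turns a section at any letter into a section at any other one. -/
theorem sec_iB_mem_secGroup (β : B) (x x' : X) :
    sec [x'] (D.iB β) ∈ secGroup [x] D.group := by
  obtain ⟨α, hα⟩ := D.perm_trans x x'
  have hx : D.iA α [x] = [x'] := by rw [D.iA_apply, hα]
  have hinv : (D.iA α)⁻¹ [x'] = [x] := by rw [← hx, RelIso.inv_apply_self]
  have hβ : D.iB β ∈ D.group := Subgroup.mem_sup_right ⟨β, rfl⟩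
  have hα' : D.iA α ∈ D.group := Subgroup.mem_sup_left ⟨α, rfl⟩
  refine ⟨(D.iA α)⁻¹ * D.iB β * D.iA α, mul_mem (mul_mem (inv_mem hα') hβ) hα', ?_, ?_⟩
  · rw [RelIso.mul_apply, RelIso.mul_apply, hx, D.iB_apply, hinv]
  · rw [sec_mul, sec_mul, hx, D.iB_apply, sec_inv, hinv, D.sec_iA, inv_one, one_mul, mul_one]

/-! ### Walks in the orbit graph of a subgroup -/

section Walks

variable {Ω : Type} [MulAction (TreeAut X) Ω]

/-- A word over `A ⊕ B` read from the point `z` is a valid walk if all its `B`-steps stay inside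
`T`; its `A`-steps are unrestricted. -/
def Valid (T : Set Ω) : Ω → List (A ⊕ B) → Prop
  | _, [] => True
  | z, .inl α :: l => Valid T (D.iA α • z) l
  | z, .inr β :: l => (z ∈ T ∧ D.iB β • z ∈ T) ∧ Valid T (D.iB β • z) l

/-- `T` carries the stabilizer of `y` if every element of the stabilizer is given by a valid
walk. -/
def Carried (y : Ω) (T : Set Ω) : Prop :=
  ∀ k : TreeAut X, k • y = y → ∃ l, D.Valid T y l ∧ D.ev l = k

theorem ev_cons_smul (s : A ⊕ B) (l : List (A ⊕ B)) (z : Ω) :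
    D.ev (s :: l) • z = D.ev l • D.el s • z := by
  rw [ev, mul_smul]

theorem valid_append {T : Set Ω} {z : Ω} {l l' : List (A ⊕ B)} :
    D.Valid T z (l ++ l') ↔ D.Valid T z l ∧ D.Valid T (D.ev l • z) l' := by
  induction l generalizing z with
  | nil => simp [Valid, ev]
  | cons s l ih => cases s <;> simp [Valid, ih, ev, mul_smul, and_assoc]

theorem valid_winv {T : Set Ω} {z : Ω} {l : List (A ⊕ B)} (h : D.Valid T z l) :
    D.Valid T (D.ev l • z) (winv l) := by
  induction l generalizing z with
  | nil => simp [winv, Valid]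
  | cons s l ih =>
    rw [winv_cons, valid_append, ev_cons_smul, ev_winv, inv_smul_smul]
    cases s with
    | inl α => exact ⟨ih h, trivial⟩
    | inr β =>
      refine ⟨ih h.2, ⟨h.1.2, ?_⟩, trivial⟩
      simpa using h.1.1

theorem Valid.mono {T T' : Set Ω} (hT : T ⊆ T') {z : Ω} {l : List (A ⊕ B)}
    (h : D.Valid T z l) : D.Valid T' z l := by
  induction l generalizing z with
  | nil => trivial
  | cons s l ih =>
    cases s with
    | inl α => exact ih h
    | inr β => exact ⟨⟨hT h.1.1, hT h.1.2⟩, ih h.2⟩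

/-- The set of the points visited by a walk. -/
def visited : Ω → List (A ⊕ B) → Set Ω
  | z, [] => {z}
  | z, s :: l => insert z (visited (D.el s • z) l)

theorem finite_visited (z : Ω) (l : List (A ⊕ B)) : (D.visited z l).Finite := by
  induction l generalizing z with
  | nil => exact Set.finite_singleton z
  | cons s l ih => exact (ih _).insert z

theorem mem_visited (z : Ω) (l : List (A ⊕ B)) : z ∈ D.visited z l := by
  cases l with
  | nil => rfl
  | cons s l => exact Set.mem_insert _ _

theorem valid_visited (z : Ω) (l : List (A ⊕ B)) : D.Valid (D.visited z l) z l := by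
  induction l generalizing z with
  | nil => trivial
  | cons s l ih =>
    have := Valid.mono D (Set.subset_insert z _) (ih (D.el s • z))
    cases s with
    | inl α => exact this
    | inr β => exact ⟨⟨Set.mem_insert _ _, Set.mem_insert_of_mem _ (D.mem_visited _ _)⟩, this⟩

/-- The stabilizer of a point is carried by a finite set as soon as it is finitely generated. -/
theorem exists_carried {y : Ω} (hG : MulAction.stabilizer (TreeAut X) y ≤ D.group)
    (hfg : (MulAction.stabilizer (TreeAut X) y).FG) : ∃ T : Set Ω, T.Finite ∧ D.Carried y T := by
  obtain ⟨S, hS⟩ := hfg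
  have hSG : ∀ s ∈ S, s ∈ D.group := fun s hs => hG (hS ▸ Subgroup.subset_closure hs)
  have hSy : ∀ s ∈ S, s • y = y := fun s hs =>
    MulAction.mem_stabilizer_iff.1 (hS ▸ Subgroup.subset_closure hs)
  choose! w hw using fun (s : TreeAut X) (hs : s ∈ S) => D.exists_ev_eq (hSG s hs)
  refine ⟨⋃ s ∈ S, D.visited y (w s), S.finite_toSet.biUnion fun s _ => D.finite_visited _ _, ?_⟩
  intro k hk
  have hk' : k ∈ Subgroup.closure (S : Set (TreeAut X)) := by
    rw [hS]
    exact hk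
  clear hk
  have key : ∀ g ∈ Subgroup.closure (S : Set (TreeAut X)),
      ∃ l, (D.Valid (⋃ s ∈ S, D.visited y (w s)) y l ∧ D.ev l = g) ∧ g • y = y := by
    intro g hg
    induction hg using Subgroup.closure_induction with
    | mem s hs =>
      exact ⟨w s, ⟨Valid.mono D (Set.subset_biUnion_of_mem hs) (D.valid_visited _ _), hw s hs⟩,
        hSy s hs⟩
    | one => exact ⟨[], ⟨trivial, rfl⟩, one_smul _ _⟩
    | mul g h _ _ ihg ihh =>
      obtain ⟨l, ⟨hl, rfl⟩, hly⟩ := ihg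
      obtain ⟨l', ⟨hl', rfl⟩, hly'⟩ := ihh
      exact ⟨l' ++ l, ⟨(D.valid_append).2 ⟨hl', hly'.symm ▸ hl⟩, D.ev_append _ _⟩,
        by rw [mul_smul, hly', hly]⟩
    | inv g _ ih =>
      obtain ⟨l, ⟨hl, rfl⟩, hly⟩ := ih
      have := D.valid_winv hl
      rw [hly] at this
      exact ⟨winv l, ⟨this, D.ev_winv l⟩, by rw [inv_smul_eq_iff, hly]⟩
  obtain ⟨l, hl, -⟩ := key k hk'
  exact ⟨l, hl⟩

/-! ### Passing to the next level -/

variable (v₀ : X) (y : Ω)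

/-- The coset space of the section group at `v₀` of the stabilizer of `y`. -/
abbrev Next : Type :=
  TreeAut X ⧸ secGroup [v₀] (MulAction.stabilizer (TreeAut X) y)

/-- The base point of the coset space: the coset of the identity. -/
def nextBase : Next v₀ y := QuotientGroup.mk 1

/-- `Lift v₀ y x z z'` says that the pair of the letter `x` and the point `z` descends to the
point `z'` of the next level: `z'` is the coset of `g_{v₀}` for an automorphism `g` which maps
`y` to `z` and `v₀` to `x`. For given `x` and `z` there is at most one such `z'`. -/
def Lift (x : X) (z : Ω) (z' : Next v₀ y) : Prop :=
  ∃ g : TreeAut X, g • y = z ∧ g [v₀] = [x] ∧ z' = QuotientGroup.mk (sec [v₀] g)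

variable {v₀ y}

theorem stabilizer_nextBase : MulAction.stabilizer (TreeAut X) (nextBase v₀ y) =
    secGroup [v₀] (MulAction.stabilizer (TreeAut X) y) :=
  MulAction.stabilizer_quotient _

theorem Lift.unique {x : X} {z : Ω} {z₁ z₂ : Next v₀ y} (h₁ : Lift v₀ y x z z₁)
    (h₂ : Lift v₀ y x z z₂) : z₁ = z₂ := by
  obtain ⟨g, hgz, hgx, rfl⟩ := h₁
  obtain ⟨g', hgz', hgx', rfl⟩ := h₂
  have hinv : g⁻¹ [x] = [v₀] := by rw [← hgx, RelIso.inv_apply_self]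
  refine QuotientGroup.eq.2 ⟨g⁻¹ * g', ?_, ?_, ?_⟩
  · rw [MulAction.mem_stabilizer_iff, mul_smul, hgz', ← hgz, inv_smul_smul]
  · rw [RelIso.mul_apply, hgx', hinv]
  · rw [sec_mul, hgx', sec_inv, hinv]

theorem lift_base : Lift v₀ y v₀ y (nextBase v₀ y) :=
  ⟨1, one_smul _ _, rfl, by rw [sec_one]; rfl⟩

theorem Lift.step {x : X} {z : Ω} {z' : Next v₀ y} (h : Lift v₀ y x z z') (s : A ⊕ B) :
    Lift v₀ y (D.lact s x) (D.el s • z) (D.el (D.letterSec x s) • z') := by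
  obtain ⟨g, rfl, hgx, rfl⟩ := h
  refine ⟨D.el s * g, mul_smul _ _ _, ?_, ?_⟩
  · rw [RelIso.mul_apply, hgx, el_apply]
  · rw [sec_mul, hgx, sec_el]
    rfl

/-- Rotations have trivial sections, so that they do not change the descendant. -/
theorem Lift.rotate {x : X} {z : Ω} {z' : Next v₀ y} (h : Lift v₀ y x z z') (α : A) :
    Lift v₀ y (D.perm α x) (D.iA α • z) z' := by
  simpa [lact, letterSec] using h.step D (.inl α)

theorem Lift.walk {x : X} {z : Ω} {z' : Next v₀ y} (h : Lift v₀ y x z z') (l : List (A ⊕ B)) :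
    Lift v₀ y (D.perm (wexp l) x) (D.ev l • z) (D.ev (D.wsec x l) • z') := by
  obtain ⟨g, rfl, hgx, rfl⟩ := h
  refine ⟨D.ev l * g, mul_smul _ _ _, ?_, ?_⟩
  · rw [RelIso.mul_apply, hgx, ev_apply]
  · rw [sec_mul, hgx, sec_ev]
    rfl

/-- The points of the next level inside of which `B`-steps are needed: `B`-steps of a walk yield
`B`-steps one level below only if they are taken at the letter `x₀`. -/
def nextSet (v₀ : X) (y : Ω) (T : Set Ω) : Set (Next v₀ y) :=
  {z' | ∃ z ∈ T, Lift v₀ y D.x₀ z z'}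

theorem Valid.wsec {T : Set Ω} {x : X} {z : Ω} {z' : Next v₀ y} {l : List (A ⊕ B)}
    (h : D.Valid T z l) (hz : Lift v₀ y x z z') :
    D.Valid (D.nextSet v₀ y T) z' (D.wsec x l) := by
  induction l generalizing x z z' with
  | nil => trivial
  | cons s l ih =>
    have hs := hz.step D s
    cases s with
    | inl α => exact ih h hs
    | inr β =>
      have hi := ih h.2 hs
      by_cases hx : x = D.x₀
      · subst hx
        simp only [lact, letterSec, if_true, Frame.wsec] at hs hi ⊢
        exact ⟨⟨⟨_, h.1.1, hz⟩, ⟨_, h.1.2, hs⟩⟩, hi⟩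
      · simp only [letterSec, hx, if_false, Frame.wsec] at hi ⊢
        exact hi

theorem Carried.next {T : Set Ω} (h : D.Carried y T) :
    D.Carried (nextBase v₀ y) (D.nextSet v₀ y T) := by
  intro k' hk'
  rw [← MulAction.mem_stabilizer_iff, stabilizer_nextBase] at hk'
  obtain ⟨k, hk, -, rfl⟩ := hk'
  obtain ⟨l, hl, rfl⟩ := h k hk
  exact ⟨D.wsec v₀ l, hl.wsec D lift_base, (D.sec_ev l v₀).symm⟩

open Classical in
/-- The map that sends `z` to the point to which the pair of `x₀` and `z` descends. -/
noncomputable def nextMap (v₀ : X) (y : Ω) (z : Ω) : Next v₀ y :=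
  if h : ∃ z', Lift v₀ y D.x₀ z z' then h.choose else nextBase v₀ y

theorem nextMap_eq {z : Ω} {z' : Next v₀ y} (h : Lift v₀ y D.x₀ z z') :
    D.nextMap v₀ y z = z' := by
  have hex : ∃ z', Lift v₀ y D.x₀ z z' := ⟨z', h⟩
  rw [nextMap, dif_pos hex]
  exact hex.choose_spec.unique h

theorem nextSet_eq (T : Set Ω) :
    D.nextSet v₀ y T = D.nextMap v₀ y '' {z ∈ T | ∃ z', Lift v₀ y D.x₀ z z'} := by
  ext z'
  constructor
  · rintro ⟨z, hz, hl⟩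
    exact ⟨z, ⟨hz, z', hl⟩, D.nextMap_eq hl⟩
  · rintro ⟨z, ⟨hz, z'', hl⟩, rfl⟩
    exact ⟨z, hz, by rwa [D.nextMap_eq hl]⟩

theorem finite_nextSet {T : Set Ω} (hT : T.Finite) : (D.nextSet v₀ y T).Finite := by
  rw [nextSet_eq]
  exact (hT.subset (Set.sep_subset _ _)).image _

theorem ncard_nextSet_le {T : Set Ω} (hT : T.Finite) : (D.nextSet v₀ y T).ncard ≤ T.ncard := by
  rw [nextSet_eq]
  exact (Set.ncard_image_le (hT.subset (Set.sep_subset _ _))).trans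
    (Set.ncard_le_ncard (Set.sep_subset _ _) hT)

/-- A point of `T` that does not descend from `x₀` is lost at the next level. -/
theorem ncard_nextSet_lt_of_not_lift {T : Set Ω} (hT : T.Finite) {z : Ω} (hz : z ∈ T)
    (h : ¬ ∃ z', Lift v₀ y D.x₀ z z') : (D.nextSet v₀ y T).ncard < T.ncard := by
  rw [nextSet_eq]
  refine (Set.ncard_image_le (hT.subset (Set.sep_subset _ _))).trans_lt
    (Set.ncard_lt_ncard ⟨Set.sep_subset _ _, fun hsub => h (hsub hz).2⟩ hT)

/-- Two points of `T` with the same descendant from `x₀` are merged at the next level. -/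
theorem ncard_nextSet_lt_of_collision {T : Set Ω} (hT : T.Finite) {z w : Ω} (hz : z ∈ T)
    (hw : w ∈ T) (hzw : z ≠ w) {z' : Next v₀ y} (hlz : Lift v₀ y D.x₀ z z')
    (hlw : Lift v₀ y D.x₀ w z') : (D.nextSet v₀ y T).ncard < T.ncard := by
  have hsub : D.nextSet v₀ y T ⊆ D.nextMap v₀ y '' (T \ {w}) := by
    rintro u' ⟨u, hu, hl⟩
    by_cases huw : u = w
    · subst huw
      exact ⟨z, ⟨hz, hzw⟩, (D.nextMap_eq hlz).trans (hlw.unique hl)⟩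
    · exact ⟨u, ⟨hu, huw⟩, D.nextMap_eq hl⟩
  exact (Set.ncard_le_ncard hsub ((hT.sdiff).image _)).trans_lt
    ((Set.ncard_image_le hT.sdiff).trans_lt (Set.ncard_sdiff_singleton_lt_of_mem hw hT))

/-! ### Stabilizers that fix the first level -/

/-- The induction hypothesis: stabilizers carried by fewer than `n` points settle. -/
def SettlesBelow (n : ℕ) : Prop :=
  ∀ (Ω : Type) [MulAction (TreeAut X) Ω] [MulAction.IsPretransitive (TreeAut X) Ω] (y : Ω)
    (T : Set Ω), T.Finite → T.ncard < n → D.Carried y T →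
      Settles D.group (MulAction.stabilizer (TreeAut X) y)

theorem settles_of_next [Finite X]
    (h : ∀ v₀ : X, Settles D.group (MulAction.stabilizer (TreeAut X) (nextBase v₀ y))) :
    Settles D.group (MulAction.stabilizer (TreeAut X) y) :=
  Settles.of_sec fun x => by
    rw [← stabilizer_nextBase]
    exact h x

/-- If a walk can only be at the letter `x₀` when it takes a `B`-step, then its `B`-steps are not
separated by rotations, so that it collapses to a single `B`-step. -/
theorem exists_ev_eq_of_lift [Nonempty X] {T : Set Ω}
    (hT : ∀ z ∈ T, ∀ x z', Lift v₀ y x z z' → x = D.x₀) {x : X} {z : Ω} {z' : Next v₀ y}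
    {l : List (A ⊕ B)} (h : D.Valid T z l) (hz : Lift v₀ y x z z') :
    ∃ γ β α, D.perm α x = D.x₀ ∧ D.ev l = D.iA γ * D.iB β * D.iA α := by
  induction l generalizing x z z' with
  | nil =>
    obtain ⟨α, hα⟩ := D.perm_trans x D.x₀
    exact ⟨α⁻¹, 1, α, hα, by simp [ev]⟩
  | cons s l ih =>
    have hs := hz.step D s
    cases s with
    | inl α =>
      obtain ⟨γ, β, α', hα', h'⟩ := ih h hs
      refine ⟨γ, β, α' * α, ?_, ?_⟩
      · rw [map_mul]
        exact hα'
      · rw [ev, h', el_inl, map_mul, mul_assoc _ (D.iA α')]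
    | inr β =>
      obtain ⟨γ, β', α', hα', h'⟩ := ih h.2 hs
      obtain rfl := hT z h.1.1 x z' hz
      obtain rfl := D.perm_free α' _ hα'
      refine ⟨γ, β' * β, 1, hα', ?_⟩
      rw [ev, h', el_inr, map_mul, map_one, mul_one, mul_one, mul_assoc]

/-- If every point of `T` descends from `x₀`, then walks collapse and the stabilizer is finite;
otherwise the next level needs fewer points. -/
theorem settles_of_fixes_level [Finite X] [Finite A] [Finite B] {n : ℕ} (IH : D.SettlesBelow n)
    {T : Set Ω} (hT : T.Finite) (hn : T.ncard ≤ n) (hc : D.Carried y T)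
    (hfix : ∀ k : TreeAut X, k • y = y → ∀ x, k [x] = [x]) :
    Settles D.group (MulAction.stabilizer (TreeAut X) y) := by
  by_cases hK : (MulAction.stabilizer (TreeAut X) y : Set (TreeAut X)).Finite
  · exact Settles.of_finite hK
  refine D.settles_of_next fun v₀ => ?_
  refine IH _ _ _ (D.finite_nextSet hT) (lt_of_lt_of_le ?_ hn) (hc.next D)
  -- A point descends only from one letter, since the stabilizer does not move letters.
  have huniq : ∀ z x x' z₁ z₂, Lift v₀ y x z z₁ → Lift v₀ y x' z z₂ → x = x' := by
    rintro z x x' _ _ ⟨g, hgz, hgx, -⟩ ⟨g', hgz', hgx', -⟩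
    have := hfix (g⁻¹ * g') (by rw [mul_smul, hgz', ← hgz, inv_smul_smul]) v₀
    rw [RelIso.mul_apply, hgx'] at this
    have h2 := congrArg g this
    rw [RelIso.apply_inv_self, hgx] at h2
    simpa using h2.symm
  by_cases hall : ∀ z ∈ T, ∃ z', Lift v₀ y D.x₀ z z'
  · refine absurd ?_ hK
    refine ((Set.finite_range fun p : A × B × A =>
      D.iA p.1 * D.iB p.2.1 * D.iA p.2.2)).subset ?_
    intro k hk
    obtain ⟨l, hl, rfl⟩ := hc k hk
    have : Nonempty X := ⟨v₀⟩
    obtain ⟨γ, β, α, -, h⟩ := D.exists_ev_eq_of_lift (fun z hz x z' hl => by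
      obtain ⟨z'', h''⟩ := hall z hz
      exact huniq _ _ _ _ _ hl h'') hl (lift_base (v₀ := v₀))
    exact ⟨(γ, β, α), h.symm⟩
  · push Not at hall
    obtain ⟨z, hz, hzl⟩ := hall
    exact D.ncard_nextSet_lt_of_not_lift hT hz (by rintro ⟨z', hz'⟩; exact hzl z' hz')

/-! ### Stabilizers that are transitive on the first level -/

/-- The stabilizer of `y` moves every letter to every other one. -/
def Rotates (y : Ω) : Prop :=
  ∀ x x' : X, ∃ k : TreeAut X, k • y = y ∧ k [x] = [x']

/-- If the stabilizer moves the letters transitively, then every pair of a letter and a point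
descends to the next level. -/
theorem Rotates.exists_lift [MulAction.IsPretransitive (TreeAut X) Ω] (h : Rotates (X := X) y)
    (x : X) (z : Ω) : ∃ z', Lift v₀ y x z z' := by
  obtain ⟨g, hg⟩ := MulAction.exists_smul_eq (TreeAut X) y z
  obtain ⟨x', hx'⟩ := exists_apply_singleton g⁻¹ x
  obtain ⟨k, hk, hkx⟩ := h v₀ x'
  refine ⟨_, g * k, by rw [mul_smul, hk, hg], ?_, rfl⟩
  rw [RelIso.mul_apply, hkx, ← hx', RelIso.apply_inv_self]

theorem ev_pow_apply (l : List (A ⊕ B)) (n : ℕ) (x : X) :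
    (D.ev l ^ n) [x] = [D.perm (wexp l ^ n) x] := by
  induction n with
  | zero => simp
  | succ n ih =>
    rw [pow_succ', RelIso.mul_apply, ih, ev_apply, pow_succ', map_mul, Equiv.Perm.mul_apply]

/-- Since `A` has prime order, one nontrivial rotation generates all of them. -/
theorem rotates_of_wexp_ne_one (hA : (Nat.card A).Prime) {l : List (A ⊕ B)}
    (hl : D.ev l • y = y) (h : wexp l ≠ 1) : Rotates (X := X) y := by
  intro x x'
  obtain ⟨γ, rfl⟩ := D.perm_trans x x'
  have : Fact (Nat.card A).Prime := ⟨hA⟩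
  obtain ⟨n, hn⟩ := mem_powers_of_prime_card (p := Nat.card A) rfl h (g' := γ)
  refine ⟨D.ev l ^ n, ?_, ?_⟩
  · rw [← MulAction.mem_stabilizer_iff]
    exact Subgroup.pow_mem _ hl n
  · rw [ev_pow_apply]
    exact congrArg (fun γ => [D.perm γ x]) hn

/-- A carried stabilizer settles if it does so whenever it contains a walk that moves the
letters. -/
theorem settles_of_rotating [Finite X] [Finite A] [Finite B] {n : ℕ} (IH : D.SettlesBelow n)
    {T : Set Ω} (hT : T.Finite) (hn : T.ncard ≤ n) (hc : D.Carried y T)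
    (h : ∀ l, D.Valid T y l → D.ev l • y = y → wexp l ≠ 1 →
      Settles D.group (MulAction.stabilizer (TreeAut X) y)) :
    Settles D.group (MulAction.stabilizer (TreeAut X) y) := by
  by_cases hfix : ∀ k : TreeAut X, k • y = y → ∀ x, k [x] = [x]
  · exact D.settles_of_fixes_level IH hT hn hc hfix
  · push Not at hfix
    obtain ⟨k, hk, x, hx⟩ := hfix
    obtain ⟨l, hl, rfl⟩ := hc k hk
    refine h l hl hk fun h1 => hx ?_
    rw [ev_apply, h1, map_one, Equiv.Perm.one_apply]

/-- A rotating stabilizer settles if it does so at the next level under the assumption that the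
descent from `x₀` is injective on `T`; otherwise the next level needs fewer points. -/
theorem settles_of_injOn [Finite X] [MulAction.IsPretransitive (TreeAut X) Ω] {n : ℕ}
    (IH : D.SettlesBelow n) {T : Set Ω} (hT : T.Finite) (hn : T.ncard ≤ n) (hc : D.Carried y T)
    (hr : Rotates (X := X) y)
    (h : ∀ v₀, Set.InjOn (D.nextMap v₀ y) T →
      Settles D.group (MulAction.stabilizer (TreeAut X) (nextBase v₀ y))) :
    Settles D.group (MulAction.stabilizer (TreeAut X) y) := by
  refine D.settles_of_next fun v₀ => ?_
  by_cases hinj : Set.InjOn (D.nextMap v₀ y) T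
  · exact h v₀ hinj
  · simp only [Set.InjOn, not_forall] at hinj
    obtain ⟨z, hz, w, hw, heq, hne⟩ := hinj
    obtain ⟨z', hz'⟩ := hr.exists_lift (v₀ := v₀) D.x₀ z
    obtain ⟨w', hw'⟩ := hr.exists_lift (v₀ := v₀) D.x₀ w
    rw [D.nextMap_eq hz', D.nextMap_eq hw'] at heq
    subst heq
    exact IH _ _ _ (D.finite_nextSet hT)
      ((D.ncard_nextSet_lt_of_collision hT hz hw hne hz' hw').trans_le hn) (hc.next D)

/-- The conclusion of the induction on the number of points. -/
theorem settles_of_fg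
    (h : ∀ n, D.SettlesBelow n → D.SettlesBelow (n + 1)) {H : Subgroup (TreeAut X)}
    (hH : H ≤ D.group) (hfg : H.FG) : Settles D.group H := by
  have hall : ∀ n, D.SettlesBelow n := fun n =>
    Nat.rec (fun _ _ _ _ _ _ hn => absurd hn (Nat.not_lt_zero _)) h n
  have hst : MulAction.stabilizer (TreeAut X) (QuotientGroup.mk 1 : TreeAut X ⧸ H) = H :=
    MulAction.stabilizer_quotient H
  obtain ⟨T, hT, hc⟩ := D.exists_carried (y := (QuotientGroup.mk 1 : TreeAut X ⧸ H))
    (by rwa [hst]) (by rwa [hst])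
  have := hall (T.ncard + 1) _ _ T hT (Nat.lt_succ_self _) hc
  rwa [hst] at this

end Walks

/-! ### Flows of walks -/

section Flows

variable {Ω : Type} [MulAction (TreeAut X) Ω]

/-- The total change of the function `f` along the `B`-steps of a walk. The values are taken
modulo 3, the number of letters in the application. -/
def flow (f : Ω → ZMod 3) : Ω → List (A ⊕ B) → ZMod 3
  | _, [] => 0
  | z, .inl α :: l => flow f (D.iA α • z) l
  | z, .inr β :: l => f (D.iB β • z) - f z + flow f (D.iB β • z) l

open Classical in
/-- The part of the flow that is due to the `B`-steps taken at the letter `x₀`, if the walk starts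
at the letter `x`. -/
noncomputable def baseFlow (f : Ω → ZMod 3) : X → Ω → List (A ⊕ B) → ZMod 3
  | _, _, [] => 0
  | x, z, .inl α :: l => baseFlow f (D.perm α x) (D.iA α • z) l
  | x, z, .inr β :: l =>
    (if x = D.x₀ then f (D.iB β • z) - f z else 0) + baseFlow f x (D.iB β • z) l

/-- The number of the `B`-steps of a word. -/
def blen : List (A ⊕ B) → ℕ
  | [] => 0
  | .inl _ :: l => blen l
  | .inr _ :: l => blen l + 1

omit [CommGroup A] [Group B] in
theorem blen_append (l l' : List (A ⊕ B)) : blen (l ++ l') = blen l + blen l' := by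
  induction l with
  | nil => simp [blen]
  | cons s l ih => cases s <;> simp [blen, ih, add_right_comm]

theorem flow_append (f : Ω → ZMod 3) (z : Ω) (l l' : List (A ⊕ B)) :
    D.flow f z (l ++ l') = D.flow f z l + D.flow f (D.ev l • z) l' := by
  induction l generalizing z with
  | nil => simp [flow, ev]
  | cons s l ih => cases s <;> simp [flow, ih, ev, mul_smul, add_assoc]

theorem flow_winv (f : Ω → ZMod 3) (z : Ω) (l : List (A ⊕ B)) :
    D.flow f (D.ev l • z) (winv l) = - D.flow f z l := by
  induction l generalizing z with
  | nil => simp [flow, winv]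
  | cons s l ih =>
    rw [winv_cons, flow_append, ev_cons_smul, ih, ev_winv, inv_smul_smul]
    cases s <;> simp [flow]

theorem flow_sub (f g : Ω → ZMod 3) (z : Ω) (l : List (A ⊕ B)) :
    D.flow (f - g) z l = D.flow f z l - D.flow g z l := by
  induction l generalizing z with
  | nil => simp [flow]
  | cons s l ih =>
    cases s with
    | inl α => simp [flow, ih]
    | inr β => simp [flow, ih]; ring

theorem flow_eq_zero {T : Set Ω} {f : Ω → ZMod 3} (hf : ∀ w ∈ T, f w = 0) {z : Ω}
    {l : List (A ⊕ B)} (h : D.Valid T z l) : D.flow f z l = 0 := by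
  induction l generalizing z with
  | nil => rfl
  | cons s l ih =>
    cases s with
    | inl α => exact ih h
    | inr β => simp [flow, ih h.2, hf _ h.1.1, hf _ h.1.2]

theorem flow_of_invariant_iA {f : Ω → ZMod 3} (hf : ∀ α z, f (D.iA α • z) = f z) (z : Ω)
    (l : List (A ⊕ B)) : D.flow f z l = f (D.ev l • z) - f z := by
  induction l generalizing z with
  | nil => simp [flow, ev]
  | cons s l ih =>
    rw [ev_cons_smul]
    cases s with
    | inl α => simp [flow, ih, hf]
    | inr β => simp [flow, ih]

theorem flow_of_invariant_iB {f : Ω → ZMod 3} (hf : ∀ β z, f (D.iB β • z) = f z) (z : Ω)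
    (l : List (A ⊕ B)) : D.flow f z l = 0 := by
  induction l generalizing z with
  | nil => rfl
  | cons s l ih => cases s <;> simp [flow, ih, hf]

theorem wsec_append (x : X) (l l' : List (A ⊕ B)) :
    D.wsec x (l ++ l') = D.wsec x l ++ D.wsec (D.perm (wexp l) x) l' := by
  induction l generalizing x with
  | nil => simp [wsec, wexp]
  | cons s l ih =>
    cases s with
    | inl α => simp [wsec, wexp, ih, lact, mul_comm α]
    | inr β => simp [wsec, wexp, ih, lact]

theorem baseFlow_append (f : Ω → ZMod 3) (x : X) (z : Ω) (l l' : List (A ⊕ B)) :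
    D.baseFlow f x z (l ++ l') =
      D.baseFlow f x z l + D.baseFlow f (D.perm (wexp l) x) (D.ev l • z) l' := by
  induction l generalizing x z with
  | nil => simp [baseFlow, wexp, ev]
  | cons s l ih =>
    cases s with
    | inl α => simp [baseFlow, wexp, ev, ih, mul_smul, mul_comm α]
    | inr β => simp [baseFlow, wexp, ev, ih, mul_smul, add_assoc]

theorem blen_wsec_le (x : X) (l : List (A ⊕ B)) : blen (D.wsec x l) ≤ blen l := by
  induction l generalizing x with
  | nil => rfl
  | cons s l ih =>
    cases s with
    | inl α => exact ih _
    | inr β =>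
      by_cases h : x = D.x₀
      · simpa [wsec, letterSec, h, blen, lact] using ih D.x₀
      · simpa [wsec, letterSec, h, blen, lact] using (ih x).trans (Nat.le_succ _)

/-- Each `B`-step of a walk is taken at `x₀` for exactly one starting letter. -/
theorem sum_blen_wsec [Fintype X] (l : List (A ⊕ B)) :
    ∑ x, blen (D.wsec x l) = blen l := by
  classical
  induction l with
  | nil => simp [wsec, blen]
  | cons s l ih =>
    cases s with
    | inl α =>
      simp only [wsec, letterSec, lact, blen]
      rw [← ih]
      exact Equiv.sum_comp (D.perm α) fun x => blen (D.wsec x l)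
    | inr β =>
      have (x : X) : blen (D.wsec x (.inr β :: l)) =
          blen (D.wsec x l) + if x = D.x₀ then 1 else 0 := by
        by_cases h : x = D.x₀ <;> simp [wsec, letterSec, h, blen, lact]
      simp only [this, Finset.sum_add_distrib, ih, Finset.sum_ite_eq', Finset.mem_univ, if_true,
        blen]

theorem sum_baseFlow [Fintype X] (f : Ω → ZMod 3) (z : Ω) (l : List (A ⊕ B)) :
    ∑ x, D.baseFlow f x z l = D.flow f z l := by
  classical
  induction l generalizing z with
  | nil => simp [baseFlow, flow]
  | cons s l ih =>
    cases s with
    | inl α =>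
      simp only [baseFlow, flow]
      rw [← ih]
      exact Equiv.sum_comp (D.perm α) fun x => D.baseFlow f x (D.iA α • z) l
    | inr β =>
      simp only [baseFlow, flow, Finset.sum_add_distrib, ih, Finset.sum_ite_eq', Finset.mem_univ,
        if_true]

/-- If all `B`-steps of a walk are taken at the letter `x₀`, then no rotation separates them. -/
theorem flow_of_blen_wsec_eq (f : Ω → ZMod 3) {x : X} {z : Ω} {l : List (A ⊕ B)}
    (h : blen (D.wsec x l) = blen l) {α α' : A} (hα : D.perm α x = D.x₀)
    (hα' : D.perm α' (D.perm (wexp l) x) = D.x₀) :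
    D.flow f z l = f (D.iA α' • D.ev l • z) - f (D.iA α • z) := by
  induction l generalizing x z α with
  | nil =>
    rw [wexp, map_one, Equiv.Perm.one_apply, ← hα, perm_eq_iff] at hα'
    simp [flow, ev, hα']
  | cons s l ih =>
    rw [ev_cons_smul]
    cases s with
    | inl γ =>
      have h1 : D.perm (α * γ⁻¹) (D.perm γ x) = D.x₀ := by
        rw [← Equiv.Perm.mul_apply, ← map_mul, inv_mul_cancel_right, hα]
      have h2 : D.perm α' (D.perm (wexp l) (D.perm γ x)) = D.x₀ := by
        rw [← hα', wexp, mul_comm γ, map_mul, Equiv.Perm.mul_apply]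
      have := ih (z := D.iA γ • z) h h1 h2
      rw [flow, this, el_inl, smul_smul (D.iA (α * γ⁻¹)), ← map_mul, inv_mul_cancel_right]
    | inr β =>
      by_cases hx : x = D.x₀
      · obtain rfl : α = 1 := D.perm_free α x (by rw [hα, hx])
        have h' : blen (D.wsec x l) = blen l := by
          simpa [wsec, letterSec, hx, blen, lact] using h
        rw [flow, ih h' hα hα', el_inr, map_one, one_smul, one_smul]
        ring
      · have h' : blen (D.wsec x l) = blen l + 1 := by
          simpa [wsec, letterSec, hx, blen, lact] using h
        have := D.blen_wsec_le x l
        omega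

variable {v₀ : X} {y : Ω}

/-- The flow of a section of a walk, for a function `f'` on the next level that corresponds to `f`
under the descent from `x₀`. -/
theorem flow_wsec {T : Set Ω} {f : Ω → ZMod 3} {f' : Next v₀ y → ZMod 3}
    (hf : ∀ w ∈ T, ∀ w', Lift v₀ y D.x₀ w w' → f' w' = f w) {x : X} {z : Ω} {z' : Next v₀ y}
    {l : List (A ⊕ B)} (h : D.Valid T z l) (hz : Lift v₀ y x z z') :
    D.flow f' z' (D.wsec x l) = D.baseFlow f x z l := by
  induction l generalizing x z z' with
  | nil => rfl
  | cons s l ih =>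
    have hs := hz.step D s
    cases s with
    | inl α => simpa [letterSec, lact, wsec, flow, baseFlow] using ih h hs
    | inr β =>
      by_cases hx : x = D.x₀
      · subst hx
        have := ih h.2 hs
        simp only [letterSec, if_true, lact, el_inr] at this hs
        simp only [wsec, letterSec, if_true, flow, baseFlow, lact, this, hf _ h.1.1 _ hz,
          hf _ h.1.2 _ hs]
      · have := ih h.2 hs
        simp only [letterSec, hx, if_false, lact, el_inl] at this
        simp only [wsec, letterSec, hx, if_false, flow, baseFlow, lact, this, zero_add]

/-- A function descends to the next level if the descent from `x₀` is injective. -/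
theorem exists_flow_function {T : Set Ω} (hT : Set.InjOn (D.nextMap v₀ y) T)
    (f : Ω → ZMod 3) :
    ∃ f' : Next v₀ y → ZMod 3, ∀ w ∈ T, ∀ w', Lift v₀ y D.x₀ w w' → f' w' = f w := by
  classical
  refine ⟨fun w' => if h : ∃ w ∈ T, D.nextMap v₀ y w = w' then f h.choose else 0, ?_⟩
  intro w hw w' hl
  have hex : ∃ w ∈ T, D.nextMap v₀ y w = w' := ⟨w, hw, D.nextMap_eq hl⟩
  refine (dif_pos hex).trans (congrArg f ?_)
  exact hT hex.choose_spec.1 hw (hex.choose_spec.2.trans (D.nextMap_eq hl).symm)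

/-- The sections of a closed walk that fixes the letters are closed. -/
theorem Lift.closed {x : X} {z : Ω} {z' : Next v₀ y} (h : Lift v₀ y x z z')
    {l : List (A ⊕ B)} (hl : D.ev l • z = z) (h1 : wexp l = 1) :
    D.ev (D.wsec x l) • z' = z' := by
  have := h.walk D l
  rw [h1, map_one, Equiv.Perm.one_apply, hl] at this
  exact this.unique h

/-- On a set on which an abelian group acts freely there is an equivariant coordinate. -/
theorem exists_position {C : Type} [CommGroup C] (i : C →* TreeAut X) (S : Set Ω)
    (h : ∀ z ∈ S, ∀ c, i c • z = z → c = 1) :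
    ∃ pos : Ω → C, ∀ z ∈ S, ∀ c, pos (i c • z) = c * pos z := by
  classical
  let R : Setoid Ω :=
    { r := fun z w => ∃ c, i c • z = w
      iseqv :=
        { refl := fun z => ⟨1, by simp⟩
          symm := by
            rintro z _ ⟨c, rfl⟩
            exact ⟨c⁻¹, by simp⟩
          trans := by
            rintro z _ _ ⟨c, rfl⟩ ⟨d, rfl⟩
            exact ⟨d * c, by rw [map_mul, mul_smul]⟩ } }
  have hrep : ∀ z : Ω, ∃ c, i c • (Quotient.mk R z).out = z := fun z => Quotient.mk_out (s := R) z
  choose pos hpos using hrep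
  refine ⟨pos, fun z hz c => ?_⟩
  have heq : Quotient.mk R (i c • z) = Quotient.mk R z :=
    Quotient.sound (s := R) ⟨c⁻¹, by simp⟩
  have h1 := hpos (i c • z)
  rw [heq] at h1
  have h2 := hpos z
  have h3 : (Quotient.mk R z).out = i (pos z)⁻¹ • z := by
    rw [map_inv, eq_inv_smul_iff, h2]
  rw [h3, smul_smul, ← map_mul] at h1
  have h4 : i (c⁻¹ * (pos (i c • z) * (pos z)⁻¹)) • z = z := by
    rw [map_mul, mul_smul, h1, smul_smul, ← map_mul, inv_mul_cancel, map_one, one_smul]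
  have h5 := h z hz _ h4
  rw [inv_mul_eq_one] at h5
  exact (eq_mul_inv_iff_mul_eq.1 h5).symm

end Flows

end Frame

/-! ### The Gupta–Sidki group -/

section Automata

variable {S X : Type*} (out : S → Equiv.Perm X) (next : S → X → S)

theorem sec_autOf (s : S) (x : X) : sec [x] (autOf out next s) = autOf out next (next s x) := by
  ext1 w
  apply List.append_cancel_left (as := autOf out next s [x])
  rw [← apply_append]
  rfl

end Automata

theorem sec_pow_eq_one {X : Type*} {g : TreeAut X} (h : ∀ x, sec [x] g = 1) (n : ℕ) (x : X) :
    sec [x] (g ^ n) = 1 := by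
  induction n generalizing x with
  | zero => exact sec_one _
  | succ n ih =>
    obtain ⟨x', hx'⟩ := exists_apply_singleton g x
    rw [pow_succ, sec_mul, hx', ih, h, one_mul]

/-- The homomorphism from the cyclic group of order `n` that sends the generator to `g`. -/
def cyclicHom {M : Type*} [Monoid M] (n : ℕ) [NeZero n] (g : M) (h : g ^ n = 1) :
    Multiplicative (ZMod n) →* M where
  toFun c := g ^ (Multiplicative.toAdd c).val
  map_one' := by simp
  map_mul' c d := by
    rw [toAdd_mul, ZMod.val_add, ← pow_eq_pow_mod _ h, pow_add]

theorem gs_e : gsGen .e = 1 := by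
  ext1 w
  change run gsOut gsNext .e w = w
  induction w with
  | nil => rfl
  | cons x w ih =>
    change gsOut .e x :: run gsOut gsNext (gsNext .e x) w = x :: w
    rw [show gsNext .e x = .e by fin_cases x <;> rfl, ih]
    rfl

theorem sec_gs_a (x : Fin 3) : sec [x] (gsGen .a) = 1 := by
  rw [gsGen, sec_autOf, ← gs_e]
  fin_cases x <;> rfl

theorem gs_a_mul_aInv : gsGen .a * gsGen .aInv = 1 := by
  apply eq_one_of_sec
  · intro x
    rw [RelIso.mul_apply]
    change [gsOut .a (gsOut .aInv x)] = _
    simp [gsOut]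
  · intro x
    rw [sec_mul]
    change sec [gsOut .aInv x] _ * _ = _
    rw [sec_gs_a, gsGen, sec_autOf, one_mul, ← gs_e]
    fin_cases x <;> rfl

theorem gs_a_pow : gsGen .a ^ 3 = 1 := by
  apply eq_one_of_sec
  · intro x
    fin_cases x <;> rfl
  · exact sec_pow_eq_one sec_gs_a 3

theorem sec_gs_t_zero : sec [0] (gsGen .t) = gsGen .a := sec_autOf _ _ _ _
theorem sec_gs_t_one : sec [1] (gsGen .t) = (gsGen .a)⁻¹ :=
  (sec_autOf _ _ _ _).trans (inv_eq_of_mul_eq_one_right gs_a_mul_aInv).symm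
theorem sec_gs_t_two : sec [2] (gsGen .t) = gsGen .t := sec_autOf _ _ _ _

theorem gs_t_apply (x : Fin 3) : gsGen .t [x] = [x] := rfl

theorem gs_t_pow : gsGen .t ^ 3 = 1 := by
  ext1 w
  change (gsGen .t ^ 3) w = w
  induction w with
  | nil => exact apply_nil _
  | cons x w ih =>
    rw [← List.singleton_append, apply_append, pow_apply_of_apply_eq (gs_t_apply x),
      sec_pow_of_apply_eq (gs_t_apply x)]
    fin_cases x
    · change _ ++ (sec [0] (gsGen .t) ^ 3) w = _
      rw [sec_gs_t_zero, gs_a_pow]; rfl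
    · change _ ++ (sec [1] (gsGen .t) ^ 3) w = _
      rw [sec_gs_t_one, inv_pow, gs_a_pow, inv_one]; rfl
    · change _ ++ (sec [2] (gsGen .t) ^ 3) w = _
      rw [sec_gs_t_two, ih]

theorem gs_a_pow_apply (n : ℕ) (x : Fin 3) : (gsGen .a ^ n) [x] = [(finRotate 3 ^ n) x] := by
  induction n with
  | zero => rfl
  | succ n ih => rw [pow_succ', pow_succ', RelIso.mul_apply, ih]; rfl

/-- The Gupta–Sidki group as generated by `A = ⟨a⟩` and `B = ⟨t⟩`. -/
def gsFrame : Frame (Fin 3) (Multiplicative (ZMod 3)) (Multiplicative (ZMod 3)) where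
  perm := cyclicHom 3 (finRotate 3) (by decide)
  perm_free := by decide
  perm_trans := by decide
  iA := cyclicHom 3 (gsGen .a) gs_a_pow
  iB := cyclicHom 3 (gsGen .t) gs_t_pow
  x₀ := 2
  σ := id
  ρ x β := if x = 0 then β else β⁻¹
  iA_apply _ x := gs_a_pow_apply _ x
  sec_iA _ x := sec_pow_eq_one sec_gs_a _ x
  iB_apply _ x := pow_apply_of_apply_eq (gs_t_apply x) _
  sec_iB_base β := (sec_pow_of_apply_eq (gs_t_apply 2) _).trans (by rw [sec_gs_t_two]; rfl)
  sec_iB β x hx := by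
    refine (sec_pow_of_apply_eq (gs_t_apply x) _).trans ?_
    by_cases h : x = 0
    · subst h
      rw [if_pos rfl, sec_gs_t_zero]
      rfl
    · obtain rfl : x = 1 := by revert hx h; revert x; decide
      rw [if_neg h, sec_gs_t_one, inv_pow, map_inv]
      rfl

theorem gsFrame_iA_generator : gsFrame.iA (Multiplicative.ofAdd 1) = gsGen .a := pow_one _

theorem gsFrame_iB_generator : gsFrame.iB (Multiplicative.ofAdd 1) = gsGen .t := pow_one _

theorem gsFrame_group : gsFrame.group = guptaSidkiGroup := by
  apply le_antisymm
  · refine sup_le ?_ ?_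
    · rintro _ ⟨α, rfl⟩
      exact Subgroup.pow_mem _ (Subgroup.subset_closure (by simp)) _
    · rintro _ ⟨β, rfl⟩
      exact Subgroup.pow_mem _ (Subgroup.subset_closure (by simp)) _
  · rw [guptaSidkiGroup, Subgroup.closure_le]
    rintro _ (rfl | rfl)
    · exact Subgroup.mem_sup_left ⟨_, gsFrame_iA_generator⟩
    · exact Subgroup.mem_sup_right ⟨_, gsFrame_iB_generator⟩

theorem gs_le_secGroup (x : Fin 3) : gsFrame.group ≤ secGroup [x] gsFrame.group := by
  have key (x' : Fin 3) : sec [x'] (gsGen .t) ∈ secGroup [x] gsFrame.group :=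
    gsFrame_iB_generator ▸ gsFrame.sec_iB_mem_secGroup _ x x'
  conv_lhs => rw [gsFrame_group]
  rw [guptaSidkiGroup, Subgroup.closure_le]
  rintro _ (rfl | rfl)
  · exact sec_gs_t_zero ▸ key 0
  · exact sec_gs_t_two ▸ key 2

/-! ### Finitely generated subgroups of the Gupta–Sidki group -/

section GSDynamics

open RootedTree.Frame

variable {Ω : Type} [MulAction (TreeAut (Fin 3)) Ω] {y : Ω} {v₀ : Fin 3} {n : ℕ}

theorem card_gs : (Nat.card (Multiplicative (ZMod 3))).Prime := by
  rw [Nat.card_eq_fintype_card]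
  decide

/-- A closed walk with a nonzero flow and fewer than `m` steps in `B` forces the stabilizer to
settle. -/
def FlowSettles (n m : ℕ) : Prop :=
  ∀ (Ω : Type) [MulAction (TreeAut (Fin 3)) Ω] [MulAction.IsPretransitive (TreeAut (Fin 3)) Ω]
    (y : Ω) (T : Set Ω), T.Finite → T.ncard ≤ n → gsFrame.Carried y T →
    ∀ f z l, gsFrame.Valid T z l → gsFrame.ev l • z = z → gsFrame.flow f z l ≠ 0 → blen l < m →
      Settles gsFrame.group (MulAction.stabilizer (TreeAut (Fin 3)) y)

/-- If the walk fixes the letters, its three sections are closed and their flows add up to the flow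
of the walk, so that one of them has a nonzero flow. This section has fewer `B`-steps: otherwise
all `B`-steps of the walk are taken at the letter `2`, and the flow is a difference of two values
that agree. -/
theorem FlowSettles.of_wexp_eq_one [MulAction.IsPretransitive (TreeAut (Fin 3)) Ω] {m : ℕ}
    (IH : gsFrame.SettlesBelow n) (h : FlowSettles n m) {T : Set Ω} (hT : T.Finite)
    (hn : T.ncard ≤ n) (hc : gsFrame.Carried y T) {f : Ω → ZMod 3} {z : Ω}
    {l : List (Multiplicative (ZMod 3) ⊕ Multiplicative (ZMod 3))} (hv : gsFrame.Valid T z l)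
    (hl : gsFrame.ev l • z = z) (hf : gsFrame.flow f z l ≠ 0) (hlen : blen l < m + 1)
    (h1 : wexp l = 1) :
    Settles gsFrame.group (MulAction.stabilizer (TreeAut (Fin 3)) y) := by
  refine gsFrame.settles_of_rotating IH hT hn hc fun lr _ hlr hrw => ?_
  have hr := gsFrame.rotates_of_wexp_ne_one card_gs hlr hrw
  refine gsFrame.settles_of_injOn IH hT hn hc hr fun v₀ hinj => ?_
  obtain ⟨f', hf'⟩ := gsFrame.exists_flow_function hinj f
  obtain ⟨x, hx⟩ : ∃ x, gsFrame.baseFlow f x z l ≠ 0 := by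
    by_contra hcon
    push Not at hcon
    rw [← gsFrame.sum_baseFlow] at hf
    exact hf (Finset.sum_eq_zero fun x _ => hcon x)
  obtain ⟨z', hz'⟩ := hr.exists_lift (v₀ := v₀) x z
  have hlt : blen (gsFrame.wsec x l) < blen l := by
    refine lt_of_le_of_ne (gsFrame.blen_wsec_le x l) fun heq => hf ?_
    obtain ⟨α, hα⟩ := gsFrame.perm_trans x gsFrame.x₀
    rw [gsFrame.flow_of_blen_wsec_eq f heq hα (α' := α) (by rw [h1, map_one]; exact hα), hl,
      sub_self]
  refine h _ _ _ (gsFrame.finite_nextSet hT) ((gsFrame.ncard_nextSet_le hT).trans hn)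
    (hc.next gsFrame) f' z' (gsFrame.wsec x l) (hv.wsec gsFrame hz')
    (hz'.closed gsFrame hl h1) ?_ (by omega)
  rwa [gsFrame.flow_wsec hf' hv hz']

/-- The product of the rotations of the three sections of a walk is trivial, because this is so for
each power of `t`. -/
theorem prod_wexp_wsec (l : List (Multiplicative (ZMod 3) ⊕ Multiplicative (ZMod 3))) :
    ∏ x, wexp (gsFrame.wsec x l) = 1 := by
  induction l with
  | nil => simp [wsec, wexp]
  | cons s l ih =>
    cases s with
    | inl α =>
      simp only [wsec, letterSec, lact, wexp, one_mul]
      rw [← ih]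
      exact Equiv.prod_comp (gsFrame.perm α) fun x => wexp (gsFrame.wsec x l)
    | inr β =>
      rw [← ih, Fin.prod_univ_three, Fin.prod_univ_three]
      have h0 : wexp (gsFrame.wsec 0 (.inr β :: l)) = β * wexp (gsFrame.wsec 0 l) := by
        rw [wsec, letterSec, if_neg (by decide)]
        rfl
      have h1 : wexp (gsFrame.wsec 1 (.inr β :: l)) = β⁻¹ * wexp (gsFrame.wsec 1 l) := by
        rw [wsec, letterSec, if_neg (by decide)]
        rfl
      have h2 : wexp (gsFrame.wsec 2 (.inr β :: l)) = wexp (gsFrame.wsec 2 l) := by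
        rw [wsec, letterSec, if_pos (by rfl)]
        rfl
      rw [h0, h1, h2, mul_mul_mul_comm, mul_inv_cancel, one_mul]

/-- A nontrivial rotation runs through all letters. -/
theorem sum_orbit {M : Type*} [AddCommMonoid M] {α : Multiplicative (ZMod 3)} (hα : α ≠ 1)
    (x : Fin 3) (φ : Fin 3 → M) :
    φ x + φ (gsFrame.perm α x) + φ (gsFrame.perm α (gsFrame.perm α x)) = ∑ x, φ x := by
  have h : ∀ α : Multiplicative (ZMod 3), α ≠ 1 → ∀ x : Fin 3,
      ({x, gsFrame.perm α x, gsFrame.perm α (gsFrame.perm α x)} : Finset (Fin 3)) = Finset.univ ∧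
      x ≠ gsFrame.perm α x ∧ x ≠ gsFrame.perm α (gsFrame.perm α x) ∧
      gsFrame.perm α x ≠ gsFrame.perm α (gsFrame.perm α x) := by decide
  obtain ⟨h0, h1, h2, h3⟩ := h α hα x
  rw [← h0, Finset.sum_insert (by simp [h1, h2]), Finset.sum_insert (by simpa using h3),
    Finset.sum_singleton, add_assoc]

/-- If the walk moves the letters, its cube is used. -/
theorem FlowSettles.succ {m : ℕ} (IH : gsFrame.SettlesBelow n) (h : FlowSettles n m) :
    FlowSettles n (m + 1) := by
  intro Ω _ _ y T hT hn hc f z l hv hl hf hlen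
  by_cases h1 : wexp l = 1
  · exact h.of_wexp_eq_one IH hT hn hc hv hl hf hlen h1
  -- The section at `0` of the cube of the walk runs through the three sections of the walk. So it
  -- has the same flow and the same number of `B`-steps as the walk, and it fixes the letters.
  refine gsFrame.settles_of_rotating IH hT hn hc fun lr _ hlr hrw => ?_
  have hr := gsFrame.rotates_of_wexp_ne_one card_gs hlr hrw
  refine gsFrame.settles_of_injOn IH hT hn hc hr fun v₀ hinj => ?_
  obtain ⟨f', hf'⟩ := gsFrame.exists_flow_function hinj f
  obtain ⟨z', hz'⟩ := hr.exists_lift (v₀ := v₀) 0 z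
  have hw : gsFrame.wsec 0 (l ++ (l ++ l)) = gsFrame.wsec 0 l ++
      (gsFrame.wsec (gsFrame.perm (wexp l) 0) l ++
        gsFrame.wsec (gsFrame.perm (wexp l) (gsFrame.perm (wexp l) 0)) l) := by
    rw [wsec_append, wsec_append]
  have hvl : gsFrame.Valid T z (l ++ (l ++ l)) := by
    simp only [valid_append, hl]
    exact ⟨hv, hv, hv⟩
  have hcl : gsFrame.ev (l ++ (l ++ l)) • z = z := by
    rw [ev_append, ev_append, mul_smul, mul_smul, hl, hl, hl]
  have hexp : wexp (l ++ (l ++ l)) = 1 := by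
    rw [wexp_append, wexp_append]
    generalize wexp l = α
    revert α
    decide
  refine h.of_wexp_eq_one IH (gsFrame.finite_nextSet hT)
    ((gsFrame.ncard_nextSet_le hT).trans hn) (hc.next gsFrame) (hvl.wsec gsFrame hz')
    (hz'.closed gsFrame hcl hexp) (f := f') ?_ ?_ ?_
  · have hflow : gsFrame.baseFlow f 0 z (l ++ (l ++ l)) = gsFrame.flow f z l := by
      simp only [baseFlow_append, hl]
      rw [← gsFrame.sum_baseFlow, ← sum_orbit h1 0, add_assoc]
    rwa [gsFrame.flow_wsec hf' hvl hz', hflow]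
  · rw [hw, blen_append, blen_append, ← add_assoc,
      sum_orbit h1 0 (fun x => blen (gsFrame.wsec x l)), sum_blen_wsec]
    exact hlen
  · rw [hw, wexp_append, wexp_append, ← mul_assoc, ← prod_wexp_wsec l]
    exact sum_orbit (M := Additive (Multiplicative (ZMod 3))) h1 0
      fun x => Additive.ofMul (wexp (gsFrame.wsec x l))

/-- A closed walk with a nonzero flow forces the stabilizer to settle, by descent on the number of
its `B`-steps. -/
theorem settles_of_flow [MulAction.IsPretransitive (TreeAut (Fin 3)) Ω]
    (IH : gsFrame.SettlesBelow n) {T : Set Ω} (hT : T.Finite) (hn : T.ncard ≤ n)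
    (hc : gsFrame.Carried y T) {f : Ω → ZMod 3} {z : Ω}
    {l : List (Multiplicative (ZMod 3) ⊕ Multiplicative (ZMod 3))} (hv : gsFrame.Valid T z l)
    (hl : gsFrame.ev l • z = z) (hf : gsFrame.flow f z l ≠ 0) :
    Settles gsFrame.group (MulAction.stabilizer (TreeAut (Fin 3)) y) := by
  have h (m : ℕ) : FlowSettles n m := by
    induction m with
    | zero =>
      intro _ _ _ _ _ _ _ _ _ _ _ _ _ _ hlt
      exact absurd hlt (Nat.not_lt_zero _)
    | succ m ih => exact ih.succ IH
  exact h (blen l + 1) _ _ _ hT hn hc _ _ _ hv hl hf (Nat.lt_succ_self _)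

/-- Two different points fixed by `A` that are joined by a walk. All sections of the walk join the
same two points of the next level, but their flows out of the first point sum up to `-1`, so that
two of them have different flows and form a closed walk with a nonzero flow. -/
theorem settles_of_two_fixed [MulAction.IsPretransitive (TreeAut (Fin 3)) Ω]
    (IH : gsFrame.SettlesBelow n) {T : Set Ω} (hT : T.Finite) (hn : T.ncard ≤ n)
    (hc : gsFrame.Carried y T) {u : Ω} (hu : ∀ α, gsFrame.iA α • u = u)
    {l : List (Multiplicative (ZMod 3) ⊕ Multiplicative (ZMod 3))} (hv : gsFrame.Valid T u l)
    (hu' : ∀ α, gsFrame.iA α • gsFrame.ev l • u = gsFrame.ev l • u)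
    (hne : gsFrame.ev l • u ≠ u) :
    Settles gsFrame.group (MulAction.stabilizer (TreeAut (Fin 3)) y) := by
  classical
  refine gsFrame.settles_of_rotating IH hT hn hc fun lr _ hlr hrw => ?_
  have hr := gsFrame.rotates_of_wexp_ne_one card_gs hlr hrw
  refine gsFrame.settles_of_injOn IH hT hn hc hr fun v₀ hinj => ?_
  have hfixed : ∀ w : Ω, (∀ α, gsFrame.iA α • w = w) → ∃ w', ∀ x, Lift v₀ y x w w' := by
    intro w hw
    obtain ⟨w', hw'⟩ := hr.exists_lift (v₀ := v₀) 0 w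
    refine ⟨w', fun x => ?_⟩
    obtain ⟨α, rfl⟩ := gsFrame.perm_trans 0 x
    have := hw'.rotate gsFrame α
    rwa [hw] at this
  obtain ⟨z₁, hz₁⟩ := hfixed u hu
  obtain ⟨z₂, hz₂⟩ := hfixed _ hu'
  let f : Ω → ZMod 3 := fun w => if w = u then 1 else 0
  have hfA : ∀ α z, f (gsFrame.iA α • z) = f z := by
    intro α z
    have : gsFrame.iA α • z = u ↔ z = u := by
      rw [← eq_inv_smul_iff, ← map_inv, hu]
    simp only [f, this]
  have hflow : gsFrame.flow f u l = -1 := by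
    rw [gsFrame.flow_of_invariant_iA hfA]
    simp [f, hne]
  obtain ⟨f', hf'⟩ := gsFrame.exists_flow_function hinj f
  have hend : ∀ x, gsFrame.ev (gsFrame.wsec x l) • z₁ = z₂ := fun x =>
    ((hz₁ x).walk gsFrame l).unique (hz₂ _)
  obtain ⟨x, x', hxx⟩ : ∃ x x', gsFrame.flow f' z₁ (gsFrame.wsec x l) ≠
      gsFrame.flow f' z₁ (gsFrame.wsec x' l) := by
    by_contra hcon
    push Not at hcon
    have hs := gsFrame.sum_baseFlow f u l
    rw [Finset.sum_congr rfl fun x _ => (gsFrame.flow_wsec hf' hv (hz₁ x)).symm.trans (hcon x 0),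
      hflow] at hs
    simp only [Finset.sum_const, Finset.card_univ, Fintype.card_fin, nsmul_eq_mul] at hs
    rw [show ((3 : ℕ) : ZMod 3) = 0 from rfl, zero_mul] at hs
    exact absurd hs (by decide)
  have hv' (x : Fin 3) := hv.wsec gsFrame (hz₁ x)
  have hback := gsFrame.valid_winv (hv' x')
  have hfback := gsFrame.flow_winv f' z₁ (gsFrame.wsec x' l)
  rw [hend] at hback hfback
  refine settles_of_flow IH (gsFrame.finite_nextSet hT) ((gsFrame.ncard_nextSet_le hT).trans hn)
    (hc.next gsFrame) (f := f') (z := z₁)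
    (l := gsFrame.wsec x l ++ winv (gsFrame.wsec x' l)) ?_ ?_ ?_
  · rw [valid_append, hend]
    exact ⟨hv' x, hback⟩
  · rw [ev_append, mul_smul, hend, ev_winv, inv_smul_eq_iff, hend]
  · rw [flow_append, hend, hfback, ← sub_eq_add_neg]
    exact sub_ne_zero.2 hxx

/-- A point `u` fixed by `A` and another point `v` fixed by `B` that are joined by a walk. At the
next level the descendants of `v` from the letters `0` and `1` are fixed by `A`. They are joined by
two sections of the walk, and counting flows shows that they are different. -/
theorem settles_of_fixed_fixed [MulAction.IsPretransitive (TreeAut (Fin 3)) Ω]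
    (IH : gsFrame.SettlesBelow n) {T : Set Ω} (hT : T.Finite) (hn : T.ncard ≤ n)
    (hc : gsFrame.Carried y T) {u v : Ω} (hu : ∀ α, gsFrame.iA α • u = u)
    (hvB : ∀ β, gsFrame.iB β • v = v) (huv : u ≠ v)
    {l : List (Multiplicative (ZMod 3) ⊕ Multiplicative (ZMod 3))} (hv : gsFrame.Valid T u l)
    (hl : gsFrame.ev l • u = v) :
    Settles gsFrame.group (MulAction.stabilizer (TreeAut (Fin 3)) y) := by
  classical
  refine gsFrame.settles_of_rotating IH hT hn hc fun lr _ hlr hrw => ?_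
  have hr := gsFrame.rotates_of_wexp_ne_one card_gs hlr hrw
  refine gsFrame.settles_of_injOn IH hT hn hc hr fun v₀ hinj => ?_
  obtain ⟨z, hz⟩ : ∃ z, ∀ x, Lift v₀ y x u z := by
    obtain ⟨w', hw'⟩ := hr.exists_lift (v₀ := v₀) 0 u
    refine ⟨w', fun x => ?_⟩
    obtain ⟨α, rfl⟩ := gsFrame.perm_trans 0 x
    have := hw'.rotate gsFrame α
    rwa [hu] at this
  -- `p c` is the section of the walk that ends at the descendant `e c` of `v` from the letter `c`.
  let p : Fin 3 → List (Multiplicative (ZMod 3) ⊕ Multiplicative (ZMod 3)) := fun c =>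
    gsFrame.wsec ((gsFrame.perm (wexp l)).symm c) l
  let e : Fin 3 → Next v₀ y := fun c => gsFrame.ev (p c) • z
  have he (c : Fin 3) : Lift v₀ y c v (e c) := by
    have := (hz ((gsFrame.perm (wexp l)).symm c)).walk gsFrame l
    rwa [hl, Equiv.apply_symm_apply] at this
  have hp (c : Fin 3) : gsFrame.Valid (gsFrame.nextSet v₀ y T) z (p c) := hv.wsec gsFrame (hz _)
  have hfix (c : Fin 3) (hc2 : c ≠ 2) (β : Multiplicative (ZMod 3)) :
      gsFrame.iA (gsFrame.ρ c β) • e c = e c := by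
    have := (he c).step gsFrame (.inr β)
    rw [letterSec, if_neg (show ¬ c = gsFrame.x₀ from hc2), el_inr, hvB] at this
    exact this.unique (he c)
  have h0 : ∀ α, gsFrame.iA α • e 0 = e 0 := fun α => hfix 0 (by decide) α
  have h1 : ∀ α, gsFrame.iA α • e 1 = e 1 := fun α => by
    have := hfix 1 (by decide) α⁻¹
    rwa [show gsFrame.ρ 1 α⁻¹ = α from inv_inv α] at this
  have hback : gsFrame.Valid (gsFrame.nextSet v₀ y T) (e 0) (winv (p 0)) :=
    gsFrame.valid_winv (hp 0)
  have hend0 : gsFrame.ev (winv (p 0)) • e 0 = z := by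
    rw [ev_winv, inv_smul_eq_iff]
  have hend : gsFrame.ev (winv (p 0) ++ p 1) • e 0 = e 1 := by
    rw [ev_append, mul_smul, hend0]
  by_cases hne : e 1 = e 0
  · exfalso
    let g : Ω → ZMod 3 := fun w => if ∃ α, gsFrame.iA α • w = v then 1 else 0
    let i : Ω → ZMod 3 := fun w => if w = v then 1 else 0
    let g' : Next v₀ y → ZMod 3 := fun w => if w = e 0 then 1 else 0
    have hg : gsFrame.flow g u l = 1 := by
      rw [gsFrame.flow_of_invariant_iA, hl]
      · have h2 : ∃ α, gsFrame.iA α • v = v := ⟨1, by simp⟩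
        have h3 : ¬ ∃ α, gsFrame.iA α • u = v := by
          rintro ⟨α, hα⟩
          exact huv ((hu α).symm.trans hα)
        simp only [g, h2, h3, if_true, if_false, sub_zero]
      · intro α w
        have : (∃ α', gsFrame.iA α' • gsFrame.iA α • w = v) ↔ ∃ α', gsFrame.iA α' • w = v := by
          constructor
          · rintro ⟨α', h⟩
            exact ⟨α' * α, by rwa [map_mul, mul_smul]⟩
          · rintro ⟨α', h⟩
            exact ⟨α' * α⁻¹, by rwa [← mul_smul, ← map_mul, inv_mul_cancel_right]⟩
        simp only [g, this]
    have hi : gsFrame.flow i u l = 0 := by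
      refine gsFrame.flow_of_invariant_iB (fun β w => ?_) u l
      have : gsFrame.iB β • w = v ↔ w = v := by
        rw [← eq_inv_smul_iff, ← map_inv, hvB]
      simp only [i, this]
    have hgi : gsFrame.flow (g - i) u l = 1 := by rw [flow_sub, hg, hi, sub_zero]
    -- The points of the rotation orbit of `v` other than `v` descend to `e 0 = e 1`.
    have hdesc : ∀ w, (g - i) w ≠ 0 → (g - i) w = 1 ∧ Lift v₀ y 2 w (e 0) := by
      intro w hw
      by_cases hwv : w = v
      · refine absurd ?_ hw
        have h2 : ∃ α, gsFrame.iA α • v = v := ⟨1, by simp⟩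
        simp only [Pi.sub_apply, g, i, h2, hwv, if_true, sub_self]
      by_cases hwa : ∃ α, gsFrame.iA α • w = v
      · refine ⟨by simp only [Pi.sub_apply, g, i, hwa, hwv, if_true, if_false, sub_zero], ?_⟩
        obtain ⟨α, hα⟩ := hwa
        have hwα : gsFrame.iA α⁻¹ • v = w := by rw [map_inv, inv_smul_eq_iff, hα]
        have hcase : ∀ α : Multiplicative (ZMod 3), α = 1 ∨ gsFrame.perm α⁻¹ 0 = 2 ∨
            gsFrame.perm α⁻¹ 1 = 2 := by decide
        rcases hcase α with rfl | h2 | h2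
        · exact absurd (by simpa using hα) hwv
        · have := (he 0).rotate gsFrame α⁻¹
          rwa [h2, hwα] at this
        · have := (he 1).rotate gsFrame α⁻¹
          rwa [h2, hwα, hne] at this
      · exact absurd (by simp only [Pi.sub_apply, g, i, hwa, hwv, if_false, sub_zero]) hw
    obtain ⟨w₀, hw₀T, hw₀⟩ : ∃ w ∈ T, (g - i) w ≠ 0 := by
      by_contra hcon
      push Not at hcon
      rw [gsFrame.flow_eq_zero hcon hv] at hgi
      exact absurd hgi (by decide)
    obtain ⟨hw₀1, hw₀l⟩ := hdesc w₀ hw₀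
    have hcomp : ∀ w ∈ T, ∀ w', Lift v₀ y gsFrame.x₀ w w' → g' w' = (g - i) w := by
      intro w hw w' hl'
      by_cases hwe : w' = e 0
      · have : w = w₀ := hinj hw hw₀T
          ((gsFrame.nextMap_eq hl').trans (hwe.trans (gsFrame.nextMap_eq hw₀l).symm))
        rw [this, hw₀1]
        simp only [g', hwe, if_true]
      · have : (g - i) w = 0 := by
          by_contra hcon
          exact hwe (hl'.unique (hdesc w hcon).2)
        rw [this]
        simp only [g', hwe, if_false]
    have hg'A : ∀ α w, g' (gsFrame.iA α • w) = g' w := by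
      intro α w
      have : gsFrame.iA α • w = e 0 ↔ w = e 0 := by
        rw [← eq_inv_smul_iff, ← map_inv, h0]
      simp only [g', this]
    -- Two of the three sections end at `e 0` and the third one may do so, but exactly one unit
    -- flows to `e 0`.
    have hsum : ∑ c, gsFrame.flow g' z (p c) = 1 := by
      rw [← hgi, ← gsFrame.sum_baseFlow]
      rw [← Equiv.sum_comp (gsFrame.perm (wexp l)).symm
        (fun x => gsFrame.baseFlow (g - i) x u l)]
      exact Finset.sum_congr rfl fun c _ => gsFrame.flow_wsec hcomp hv (hz _)
    rw [Finset.sum_congr rfl fun c _ => gsFrame.flow_of_invariant_iA hg'A z (p c),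
      Fin.sum_univ_three] at hsum
    change g' (e 0) - g' z + (g' (e 1) - g' z) + (g' (e 2) - g' z) = 1 at hsum
    rw [hne, show g' (e 0) = 1 from if_pos rfl] at hsum
    have h2 : g' (e 2) = 0 ∨ g' (e 2) = 1 := by
      by_cases h : e 2 = e 0 <;> simp [g', h]
    generalize g' z = a at hsum
    rcases h2 with h2 | h2 <;> rw [h2] at hsum <;> revert hsum <;> revert a <;> decide
  · exact settles_of_two_fixed IH (gsFrame.finite_nextSet hT)
      ((gsFrame.ncard_nextSet_le hT).trans hn) (hc.next gsFrame) h0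
      ((gsFrame.valid_append).2 ⟨hback, by rw [hend0]; exact hp 1⟩)
      (by rw [hend]; exact h1) (by rw [hend]; exact hne)

/-- The rotation of a section of a walk is determined by the flow of a coordinate on the orbits of
`B`, because `t` has the sections `a`, `a⁻¹` and `t`. -/
theorem wexp_wsec_eq {T : Set Ω} {pos : Ω → Multiplicative (ZMod 3)}
    (hpos : ∀ z ∈ T, ∀ β, pos (gsFrame.iB β • z) = β * pos z) (x : Fin 3) {z : Ω}
    {l : List (Multiplicative (ZMod 3) ⊕ Multiplicative (ZMod 3))} (h : gsFrame.Valid T z l) :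
    Multiplicative.toAdd (wexp (gsFrame.wsec x l)) =
      gsFrame.baseFlow (fun w => Multiplicative.toAdd (pos w))
          (gsFrame.perm (Multiplicative.ofAdd 2) x) z l -
        gsFrame.baseFlow (fun w => Multiplicative.toAdd (pos w))
          (gsFrame.perm (Multiplicative.ofAdd 1) x) z l := by
  induction l generalizing x z with
  | nil => rfl
  | cons s l ih =>
    cases s with
    | inl α =>
      have hcomm (γ : Multiplicative (ZMod 3)) : gsFrame.perm α (gsFrame.perm γ x) =
          gsFrame.perm γ (gsFrame.perm α x) := by
        rw [← Equiv.Perm.mul_apply, ← map_mul, mul_comm, map_mul, Equiv.Perm.mul_apply]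
      simp only [wsec, letterSec, lact, wexp, one_mul, baseFlow, hcomm]
      exact ih _ h
    | inr β =>
      have hi := ih x h.2
      have hδ : Multiplicative.toAdd (pos (gsFrame.iB β • z)) - Multiplicative.toAdd (pos z) =
          Multiplicative.toAdd β := by
        rw [hpos z h.1.1, toAdd_mul, add_sub_cancel_right]
      simp only [baseFlow, hδ]
      have hcase : ∀ x : Fin 3, x = 0 ∨ x = 1 ∨ x = 2 := by decide
      rcases hcase x with rfl | rfl | rfl
      · rw [wsec, letterSec, if_neg (by decide), if_pos (by decide), if_neg (by decide)]
        change Multiplicative.toAdd (β * wexp (gsFrame.wsec 0 l)) = _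
        rw [toAdd_mul, hi]
        ring
      · rw [wsec, letterSec, if_neg (by decide), if_neg (by decide), if_pos (by decide)]
        change Multiplicative.toAdd (β⁻¹ * wexp (gsFrame.wsec 1 l)) = _
        rw [toAdd_mul, toAdd_inv, hi]
        ring
      · rw [wsec, letterSec, if_pos (by rfl), if_neg (by decide), if_neg (by decide)]
        change Multiplicative.toAdd (wexp (gsFrame.wsec 2 l)) = _
        rw [hi]
        ring

/-- If `B` acts freely on the points where it is used, then a rotation at the next level produces a
flow. -/
theorem settles_of_iB_free [MulAction.IsPretransitive (TreeAut (Fin 3)) Ω]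
    (IH : gsFrame.SettlesBelow n) {T : Set Ω} (hT : T.Finite) (hn : T.ncard ≤ n)
    (hc : gsFrame.Carried y T) (hfree : ∀ z ∈ T, ∀ β, gsFrame.iB β • z = z → β = 1) :
    Settles gsFrame.group (MulAction.stabilizer (TreeAut (Fin 3)) y) := by
  refine gsFrame.settles_of_rotating IH hT hn hc fun lr _ hlr hrw => ?_
  have hr := gsFrame.rotates_of_wexp_ne_one card_gs hlr hrw
  refine gsFrame.settles_of_injOn IH hT hn hc hr fun v₀ hinj => ?_
  have hT' := gsFrame.finite_nextSet (v₀ := v₀) (y := y) hT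
  have hn' := (gsFrame.ncard_nextSet_le (v₀ := v₀) (y := y) hT).trans hn
  refine gsFrame.settles_of_rotating IH hT' hn' (hc.next gsFrame) fun l' _ hl' hw' => ?_
  obtain ⟨l, hv, hly, h1, hw⟩ : ∃ l, gsFrame.Valid T y l ∧ gsFrame.ev l • y = y ∧ wexp l = 1 ∧
      wexp (gsFrame.wsec v₀ l) ≠ 1 := by
    rw [← MulAction.mem_stabilizer_iff, stabilizer_nextBase] at hl'
    obtain ⟨k, hk, hkv, hks⟩ := hl'
    obtain ⟨l, hl, rfl⟩ := hc k hk
    refine ⟨l, hl, hk, ?_, ?_⟩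
    · rw [ev_apply] at hkv
      exact gsFrame.perm_free _ v₀ (by simpa using hkv)
    · rw [sec_ev] at hks
      have h2 := congrArg (fun g : TreeAut (Fin 3) => g [0]) hks
      simp only [ev_apply, List.cons.injEq, and_true] at h2
      rw [perm_eq_iff] at h2
      rwa [h2]
  obtain ⟨pos, hpos⟩ := exists_position gsFrame.iB T hfree
  obtain ⟨f', hf'⟩ := gsFrame.exists_flow_function hinj fun w => Multiplicative.toAdd (pos w)
  by_cases hex : ∃ x, gsFrame.baseFlow (fun w => Multiplicative.toAdd (pos w)) x y l ≠ 0
  · obtain ⟨x, hx⟩ := hex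
    obtain ⟨z', hz'⟩ := hr.exists_lift (v₀ := v₀) x y
    exact settles_of_flow IH hT' hn' (hc.next gsFrame) (hv.wsec gsFrame hz')
      (hz'.closed gsFrame hly h1) (by rwa [gsFrame.flow_wsec hf' hv hz'])
  · push Not at hex
    refine absurd ?_ hw
    have := wexp_wsec_eq hpos v₀ hv
    rw [hex, hex, sub_zero] at this
    exact toAdd_eq_zero.1 this

/-- In a group of order 3 a nontrivial element generates. -/
theorem smul_eq_of_smul_eq {i : Multiplicative (ZMod 3) →* TreeAut (Fin 3)} {z : Ω}
    {γ : Multiplicative (ZMod 3)} (hγ : γ ≠ 1) (h : i γ • z = z) (δ : Multiplicative (ZMod 3)) :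
    i δ • z = z := by
  have : Fact (Nat.card (Multiplicative (ZMod 3))).Prime := ⟨card_gs⟩
  obtain ⟨m, rfl⟩ := mem_powers_of_prime_card rfl hγ (g' := δ)
  change i (γ ^ m) • z = z
  rw [map_pow, ← MulAction.mem_stabilizer_iff]
  exact Subgroup.pow_mem _ h m

/-- Along a walk, the coordinate `pos` on the free orbits of `A` changes by the rotations of the
`A`-steps and by the flow of the `B`-steps. In particular a closed walk that moves the letters has a
nonzero flow. -/
theorem wexp_add_flow {R : Set Ω} (hRA : ∀ z ∈ R, ∀ α, gsFrame.iA α • z ∈ R) {T : Set Ω}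
    (hTR : ∀ z ∈ R, ∀ β, z ∈ T → gsFrame.iB β • z ∈ T → gsFrame.iB β • z ∈ R)
    {pos : Ω → Multiplicative (ZMod 3)}
    (hpos : ∀ z ∈ R, ∀ α, pos (gsFrame.iA α • z) = α * pos z) {z : Ω} (hz : z ∈ R)
    {l : List (Multiplicative (ZMod 3) ⊕ Multiplicative (ZMod 3))} (h : gsFrame.Valid T z l) :
    Multiplicative.toAdd (wexp l) + gsFrame.flow (fun w => Multiplicative.toAdd (pos w)) z l =
      Multiplicative.toAdd (pos (gsFrame.ev l • z)) - Multiplicative.toAdd (pos z) := by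
  induction l generalizing z with
  | nil => simp [wexp, flow, ev]
  | cons s l ih =>
    rw [ev_cons_smul]
    cases s with
    | inl α =>
      have := ih (hRA z hz α) h
      rw [el_inl, wexp, flow, toAdd_mul, add_assoc, this, hpos z hz, toAdd_mul]
      ring
    | inr β =>
      have := ih (hTR z hz β h.1.1 h.1.2) h.2
      rw [el_inr, wexp, flow, add_left_comm, this]
      ring

/-- If `A` acts freely on the points in reach, a walk that moves the letters has a nonzero flow. If
`B` acts freely on the points of `T` in reach, a walk that moves the letters one level below has a
section with a nonzero flow. Otherwise there are a point fixed by `A` and a point fixed by `B`. -/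
theorem gs_settlesBelow_succ (IH : gsFrame.SettlesBelow n) : gsFrame.SettlesBelow (n + 1) := by
  intro Ω _ _ y T₀ hT₀ hn₀ hc₀
  -- Only the points that can be reached from the base point matter.
  let R : Set Ω := {z | ∃ l, gsFrame.Valid T₀ y l ∧ gsFrame.ev l • y = z}
  have hyR : y ∈ R := ⟨[], trivial, one_smul _ _⟩
  have hRA : ∀ z ∈ R, ∀ α, gsFrame.iA α • z ∈ R := by
    rintro _ ⟨l, hl, rfl⟩ α
    refine ⟨l ++ [.inl α], (gsFrame.valid_append).2 ⟨hl, ?_⟩, ?_⟩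
    · trivial
    · rw [ev_append, mul_smul]
      simp [ev]
  have hRB : ∀ z ∈ R, ∀ β, z ∈ T₀ → gsFrame.iB β • z ∈ T₀ → gsFrame.iB β • z ∈ R := by
    rintro _ ⟨l, hl, rfl⟩ β h1 h2
    refine ⟨l ++ [.inr β], (gsFrame.valid_append).2 ⟨hl, ?_⟩, ?_⟩
    · exact ⟨⟨h1, h2⟩, trivial⟩
    · rw [ev_append, mul_smul]
      simp [ev]
  have hvalid : ∀ l z, z ∈ R → gsFrame.Valid T₀ z l → gsFrame.Valid (T₀ ∩ R) z l := by
    intro l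
    induction l with
    | nil => exact fun _ _ _ => trivial
    | cons s l ih =>
      intro z hz h
      cases s with
      | inl α => exact ih _ (hRA z hz α) h
      | inr β =>
        have hz' := hRB z hz β h.1.1 h.1.2
        exact ⟨⟨⟨h.1.1, hz⟩, h.1.2, hz'⟩, ih _ hz' h.2⟩
  set T := T₀ ∩ R with hTdef
  have hT : T.Finite := hT₀.subset Set.inter_subset_left
  have hn : T.ncard ≤ n := (Set.ncard_le_ncard Set.inter_subset_left hT₀).trans (by omega)
  have hc : gsFrame.Carried y T := by
    intro k hk
    obtain ⟨l, hl, hlk⟩ := hc₀ k hk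
    exact ⟨l, hvalid l y hyR hl, hlk⟩
  have hreach : ∀ z ∈ R, ∃ l, gsFrame.Valid T y l ∧ gsFrame.ev l • y = z := by
    rintro z ⟨l, hl, hlz⟩
    exact ⟨l, hvalid l y hyR hl, hlz⟩
  refine gsFrame.settles_of_rotating IH hT hn hc fun l hv hl hw => ?_
  by_cases hA : ∀ z ∈ R, ∀ α, gsFrame.iA α • z = z → α = 1
  · obtain ⟨pos, hpos⟩ := exists_position gsFrame.iA R hA
    refine settles_of_flow IH hT hn hc (f := fun w => Multiplicative.toAdd (pos w)) hv hl
      fun h0 => hw ?_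
    have := wexp_add_flow hRA (T := T) (fun z _ β _ h2 => h2.2) hpos hyR hv
    rw [h0, hl, sub_self, add_zero] at this
    exact toAdd_eq_zero.1 this
  by_cases hB : ∀ z ∈ T, ∀ β, gsFrame.iB β • z = z → β = 1
  · exact settles_of_iB_free IH hT hn hc hB
  push Not at hA hB
  obtain ⟨u, huR, α, hαu, hα⟩ := hA
  obtain ⟨v, hvT, β, hβv, hβ⟩ := hB
  have hu := smul_eq_of_smul_eq hα hαu
  have hvB := smul_eq_of_smul_eq hβ hβv
  obtain ⟨lu, hlu, hlu'⟩ := hreach u huR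
  obtain ⟨lv, hlv, hlv'⟩ := hreach v hvT.2
  by_cases huv : u = v
  · -- A point fixed by `A` and by `B` is fixed by the whole group.
    subst huv
    have hfixu : ∀ g ∈ gsFrame.group, g • u = u := by
      have : gsFrame.group ≤ MulAction.stabilizer (TreeAut (Fin 3)) u := by
        refine sup_le ?_ ?_
        · rintro _ ⟨γ, rfl⟩
          exact hu γ
        · rintro _ ⟨γ, rfl⟩
          exact hvB γ
      exact this
    refine Settles.of_le gs_le_secGroup fun g hg => ?_
    have hyu : (gsFrame.ev lu)⁻¹ • u = y := by rw [inv_smul_eq_iff, hlu']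
    have hyy : y = u := hyu.symm.trans (hfixu _ (inv_mem (gsFrame.ev_mem lu)))
    rw [hyy]
    exact hfixu g hg
  · have hback := gsFrame.valid_winv hlu
    rw [hlu'] at hback
    have hend : gsFrame.ev (winv lu) • u = y := by rw [ev_winv, inv_smul_eq_iff, hlu']
    exact settles_of_fixed_fixed IH hT hn hc hu hvB huv (l := winv lu ++ lv)
      ((gsFrame.valid_append).2 ⟨hback, by rwa [hend]⟩)
      (by rw [ev_append, mul_smul, hend, hlv'])

theorem guptaSidki_obeysGN : ObeysGNAlternative guptaSidkiGroup := by
  rw [← gsFrame_group]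
  exact ObeysGNAlternative.of_settles (fun g hg x => gsFrame.sec_mem hg x) fun H hH hfg =>
    gsFrame.settles_of_fg (fun _ => gs_settlesBelow_succ) hH hfg

end GSDynamics

/-! ### The Grigorchuk group -/

theorem grig_e : grigGen .e = 1 := by
  ext1 w
  change run grigOut grigNext .e w = w
  induction w with
  | nil => rfl
  | cons x w ih =>
    change grigOut .e x :: run grigOut grigNext .e w = x :: w
    rw [ih]
    rfl

theorem sec_grig_a (x : Fin 2) : sec [x] (grigGen .a) = 1 := by
  rw [grigGen, sec_autOf, ← grig_e]
  rfl

theorem grig_a_sq : grigGen .a ^ 2 = 1 := by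
  apply eq_one_of_sec
  · intro x
    fin_cases x <;> rfl
  · exact sec_pow_eq_one sec_grig_a 2

theorem sec_grig_b_zero : sec [0] (grigGen .b) = grigGen .a := sec_autOf _ _ _ _
theorem sec_grig_b_one : sec [1] (grigGen .b) = grigGen .c := sec_autOf _ _ _ _
theorem sec_grig_c_zero : sec [0] (grigGen .c) = grigGen .a := sec_autOf _ _ _ _
theorem sec_grig_c_one : sec [1] (grigGen .c) = grigGen .d := sec_autOf _ _ _ _
theorem sec_grig_d_zero : sec [0] (grigGen .d) = 1 := (sec_autOf _ _ _ _).trans grig_e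
theorem sec_grig_d_one : sec [1] (grigGen .d) = grigGen .b := sec_autOf _ _ _ _

theorem grig_b_apply (x : Fin 2) : grigGen .b [x] = [x] := rfl
theorem grig_c_apply (x : Fin 2) : grigGen .c [x] = [x] := rfl
theorem grig_d_apply (x : Fin 2) : grigGen .d [x] = [x] := rfl

/-- The multiplication table of the Klein four-group `{1, b, c, d}`. The entries depend on each
other at deeper levels, so that they are proved together. -/
theorem grig_klein_apply (w : List (Fin 2)) :
    (grigGen .b (grigGen .b w) = w ∧ grigGen .c (grigGen .c w) = w ∧
      grigGen .d (grigGen .d w) = w) ∧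
    (grigGen .b (grigGen .c w) = grigGen .d w ∧ grigGen .c (grigGen .d w) = grigGen .b w ∧
      grigGen .d (grigGen .b w) = grigGen .c w) ∧
    (grigGen .c (grigGen .b w) = grigGen .d w ∧ grigGen .d (grigGen .c w) = grigGen .b w ∧
      grigGen .b (grigGen .d w) = grigGen .c w) := by
  induction w with
  | nil => simp [apply_nil]
  | cons x w ih =>
    obtain ⟨⟨h1, h2, h3⟩, ⟨h4, h5, h6⟩, h7, h8, h9⟩ := ih
    have ha : grigGen .a (grigGen .a w) = w := by
      have := congrArg (fun g : TreeAut (Fin 2) => g w) grig_a_sq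
      simpa [pow_two] using this
    have hcases : ∀ x : Fin 2, x = 0 ∨ x = 1 := by decide
    have hb (x : Fin 2) (w) : grigGen .b (x :: w) = x :: sec [x] (grigGen .b) w :=
      apply_append (grigGen .b) [x] w
    have hc (x : Fin 2) (w) : grigGen .c (x :: w) = x :: sec [x] (grigGen .c) w :=
      apply_append (grigGen .c) [x] w
    have hd (x : Fin 2) (w) : grigGen .d (x :: w) = x :: sec [x] (grigGen .d) w :=
      apply_append (grigGen .d) [x] w
    rcases hcases x with rfl | rfl
    · simp only [hb, hc, hd, sec_grig_b_zero, sec_grig_c_zero, sec_grig_d_zero,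
        RelIso.coe_one, id, ha, and_self]
    · simp only [hb, hc, hd, sec_grig_b_one, sec_grig_c_one, sec_grig_d_one, h1, h2, h3, h4, h5,
        h6, h7, h8, h9, and_self]

theorem grig_b_sq : grigGen .b ^ 2 = 1 := by
  rw [pow_two]
  ext1 w
  exact (grig_klein_apply w).1.1

theorem grig_c_sq : grigGen .c ^ 2 = 1 := by
  rw [pow_two]
  ext1 w
  exact (grig_klein_apply w).1.2.1

theorem grig_d_sq : grigGen .d ^ 2 = 1 := by
  rw [pow_two]
  ext1 w
  exact (grig_klein_apply w).1.2.2

theorem grig_b_mul_c : grigGen .b * grigGen .c = grigGen .d := by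
  ext1 w
  exact (grig_klein_apply w).2.1.1

theorem grig_c_mul_b : grigGen .c * grigGen .b = grigGen .d := by
  ext1 w
  exact (grig_klein_apply w).2.2.1

/-- The cyclic group of order 2, written multiplicatively. -/
abbrev C2 : Type := Multiplicative (ZMod 2)

/-- The embedding of the Klein four-group with `b` and `c` as generators. -/
def grigKlein : C2 × C2 →* TreeAut (Fin 2) :=
  MonoidHom.noncommCoprod (cyclicHom 2 (grigGen .b) grig_b_sq) (cyclicHom 2 (grigGen .c) grig_c_sq)
    fun _ _ => Commute.pow_pow (grig_b_mul_c.trans grig_c_mul_b.symm) _ _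

/-- The generator of `C2`. -/
abbrev gen2 : C2 := Multiplicative.ofAdd 1

theorem grigKlein_b : grigKlein (gen2, 1) = grigGen .b := by
  change grigGen .b ^ 1 * grigGen .c ^ 0 = _
  rw [pow_one, pow_zero, mul_one]

theorem grigKlein_c : grigKlein (1, gen2) = grigGen .c := by
  change grigGen .b ^ 0 * grigGen .c ^ 1 = _
  rw [pow_one, pow_zero, one_mul]

theorem grigKlein_d : grigKlein (gen2, gen2) = grigGen .d := by
  change grigGen .b ^ 1 * grigGen .c ^ 1 = _
  rw [pow_one, pow_one, grig_b_mul_c]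

theorem klein_cases : ∀ β : C2 × C2, β = 1 ∨ β = (gen2, 1) ∨ β = (1, gen2) ∨ β = (gen2, gen2) := by
  decide

theorem C2_cases : ∀ α : C2, α = 1 ∨ α = gen2 := by decide

theorem grig_a_pow_apply (n : ℕ) (x : Fin 2) :
    (grigGen .a ^ n) [x] = [(Equiv.swap (0 : Fin 2) 1 ^ n) x] := by
  induction n with
  | zero => rfl
  | succ n ih => rw [pow_succ', pow_succ', RelIso.mul_apply, ih]; rfl

/-- The Grigorchuk group as generated by `A = ⟨a⟩` and `B = {1, b, c, d}`. -/
def grigFrame : Frame (Fin 2) C2 (C2 × C2) where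
  perm := cyclicHom 2 (Equiv.swap 0 1) (by decide)
  perm_free := by decide
  perm_trans := by decide
  iA := cyclicHom 2 (grigGen .a) grig_a_sq
  iB := grigKlein
  x₀ := 1
  σ β := (β.2, β.1 * β.2)
  ρ _ β := β.1 * β.2
  iA_apply _ x := grig_a_pow_apply _ x
  sec_iA _ x := sec_pow_eq_one sec_grig_a _ x
  iB_apply β x := by
    rcases klein_cases β with rfl | rfl | rfl | rfl
    · rw [map_one]; rfl
    · rw [grigKlein_b]; rfl
    · rw [grigKlein_c]; rfl
    · rw [grigKlein_d]; rfl
  sec_iB_base β := by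
    rcases klein_cases β with rfl | rfl | rfl | rfl
    · exact (map_one grigKlein ▸ sec_one _).trans (map_one grigKlein).symm
    · rw [grigKlein_b, sec_grig_b_one]
      exact grigKlein_c.symm
    · rw [grigKlein_c, sec_grig_c_one]
      exact grigKlein_d.symm
    · rw [grigKlein_d, sec_grig_d_one]
      exact grigKlein_b.symm
  sec_iB β x hx := by
    obtain rfl : x = 0 := by revert hx; revert x; decide
    rcases klein_cases β with rfl | rfl | rfl | rfl
    · rw [map_one, sec_one]; rfl
    · rw [grigKlein_b, sec_grig_b_zero]
      exact (pow_one _).symm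
    · rw [grigKlein_c, sec_grig_c_zero]
      exact (pow_one _).symm
    · rw [grigKlein_d, sec_grig_d_zero]; rfl

theorem grigFrame_iA_gen2 : grigFrame.iA gen2 = grigGen .a := pow_one _

theorem grigFrame_group : grigFrame.group = grigorchukGroup := by
  apply le_antisymm
  · refine sup_le ?_ ?_
    · rintro _ ⟨α, rfl⟩
      exact Subgroup.pow_mem _ (Subgroup.subset_closure (by simp)) _
    · rintro _ ⟨β, rfl⟩
      change grigKlein β ∈ _
      rcases klein_cases β with rfl | rfl | rfl | rfl
      · rw [map_one]
        exact one_mem _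
      · rw [grigKlein_b]
        exact Subgroup.subset_closure (by simp)
      · rw [grigKlein_c]
        exact Subgroup.subset_closure (by simp)
      · rw [grigKlein_d]
        exact Subgroup.subset_closure (by simp)
  · rw [grigorchukGroup, Subgroup.closure_le]
    rintro _ (rfl | rfl | rfl | rfl)
    · exact Subgroup.mem_sup_left ⟨_, grigFrame_iA_gen2⟩
    · exact Subgroup.mem_sup_right ⟨_, grigKlein_b⟩
    · exact Subgroup.mem_sup_right ⟨_, grigKlein_c⟩
    · exact Subgroup.mem_sup_right ⟨_, grigKlein_d⟩

theorem grig_le_secGroup (x : Fin 2) : grigFrame.group ≤ secGroup [x] grigFrame.group := by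
  have key (β : C2 × C2) (x' : Fin 2) : sec [x'] (grigKlein β) ∈ secGroup [x] grigFrame.group :=
    grigFrame.sec_iB_mem_secGroup β x x'
  conv_lhs => rw [grigFrame_group]
  rw [grigorchukGroup, Subgroup.closure_le]
  rintro _ (rfl | rfl | rfl | rfl)
  · exact sec_grig_b_zero ▸ grigKlein_b ▸ key (gen2, 1) 0
  · exact sec_grig_d_one ▸ grigKlein_d ▸ key (gen2, gen2) 1
  · exact sec_grig_b_one ▸ grigKlein_b ▸ key (gen2, 1) 1
  · exact sec_grig_c_one ▸ grigKlein_c ▸ key (1, gen2) 1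

/-! ### Finite dihedral subgroups -/

theorem isOfFinOrder_of_sec {X : Type*} [Finite X] {g : TreeAut X} (h : ∀ x, g [x] = [x])
    (h' : ∀ x, IsOfFinOrder (sec [x] g)) : IsOfFinOrder g := by
  cases nonempty_fintype X
  rw [isOfFinOrder_iff_pow_eq_one]
  refine ⟨∏ x, orderOf (sec [x] g), Finset.prod_pos fun x _ => (h' x).orderOf_pos, ?_⟩
  refine eq_one_of_sec (fun x => pow_apply_of_apply_eq (h x) _) fun x => ?_
  rw [sec_pow_of_apply_eq (h x)]
  exact orderOf_dvd_iff_pow_eq_one.1 (Finset.dvd_prod_of_mem _ (Finset.mem_univ x))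

theorem finite_closure_pair {M : Type*} [Group M] {a x : M} (ha : a ^ 2 = 1) (hx : x ^ 2 = 1)
    (hax : IsOfFinOrder (a * x)) : (Subgroup.closure {a, x} : Set M).Finite := by
  set r := a * x with hr
  have ha' : a⁻¹ = a := inv_eq_of_mul_eq_one_left (by rw [← pow_two, ha])
  have hx' : x⁻¹ = x := inv_eq_of_mul_eq_one_left (by rw [← pow_two, hx])
  have hconj (k : ℤ) : a * r ^ k = r ^ (-k) * a := by
    have h1 : a * r * a⁻¹ = r⁻¹ := by
      rw [hr, mul_inv_rev, hx', ha', ← mul_assoc, ← pow_two, ha, one_mul]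
    rw [zpow_neg, ← inv_zpow, ← h1, conj_zpow, inv_mul_cancel_right]
  have hfin : (Subgroup.zpowers r : Set M).Finite := finite_zpowers.2 hax
  refine (hfin.union (hfin.image (· * a))).subset fun g hg => ?_
  have key : ∃ k : ℤ, g = r ^ k ∨ g = r ^ k * a := by
    induction hg using Subgroup.closure_induction with
    | mem g h =>
      rcases h with rfl | rfl
      · exact ⟨0, Or.inr (by simp)⟩
      · refine ⟨-1, Or.inr ?_⟩
        rw [← hconj, zpow_one, hr, ← mul_assoc, ← pow_two, ha, one_mul]
    | one => exact ⟨0, Or.inl (zpow_zero r).symm⟩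
    | mul g h _ _ ihg ihh =>
      obtain ⟨k, rfl | rfl⟩ := ihg <;> obtain ⟨m, rfl | rfl⟩ := ihh
      · exact ⟨k + m, Or.inl (zpow_add _ _ _).symm⟩
      · exact ⟨k + m, Or.inr (by rw [zpow_add, mul_assoc])⟩
      · exact ⟨k + -m, Or.inr (by rw [mul_assoc, hconj, zpow_add, mul_assoc])⟩
      · refine ⟨k + -m, Or.inl ?_⟩
        rw [mul_assoc, ← mul_assoc a, hconj, mul_assoc, ← pow_two, ha, mul_one, zpow_add]
    | inv g _ ih =>
      obtain ⟨k, rfl | rfl⟩ := ih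
      · exact ⟨-k, Or.inl (zpow_neg _ _).symm⟩
      · refine ⟨k, Or.inr ?_⟩
        rw [mul_inv_rev, ha', ← zpow_neg, hconj, neg_neg]
  obtain ⟨k, rfl | rfl⟩ := key
  · exact Or.inl ⟨k, rfl⟩
  · exact Or.inr ⟨_, ⟨k, rfl⟩, rfl⟩

theorem isOfFinOrder_grig_a_mul {x : TreeAut (Fin 2)} (hx : ∀ i : Fin 2, x [i] = [i])
    (h : IsOfFinOrder (sec [1] x * sec [0] x)) (h' : IsOfFinOrder (sec [0] x * sec [1] x)) :
    IsOfFinOrder (grigGen .a * x) := by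
  refine IsOfFinOrder.of_pow (n := 2) ?_ two_ne_zero
  have ha0 : grigGen .a [0] = [1] := rfl
  have ha1 : grigGen .a [1] = [0] := rfl
  have hcases : ∀ i : Fin 2, i = 0 ∨ i = 1 := by decide
  rw [pow_two]
  refine isOfFinOrder_of_sec (fun i => ?_) fun i => ?_
  · rcases hcases i with rfl | rfl <;> simp only [RelIso.mul_apply, hx, ha0, ha1]
  · rcases hcases i with rfl | rfl
    · simpa only [sec_mul, RelIso.mul_apply, hx, ha0, ha1, sec_grig_a, one_mul] using h
    · simpa only [sec_mul, RelIso.mul_apply, hx, ha0, ha1, sec_grig_a, one_mul] using h'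

/-- The dihedral groups `⟨a, d⟩`, `⟨a, c⟩` and `⟨a, b⟩` are finite; each one is reduced to the one
before by taking sections. -/
theorem finite_closure_grig {β : C2 × C2} (hβ : β ≠ 1) :
    (Subgroup.closure {grigGen .a, grigKlein β} : Set (TreeAut (Fin 2))).Finite := by
  have hb : IsOfFinOrder (grigGen .b) := isOfFinOrder_iff_pow_eq_one.2 ⟨2, two_pos, grig_b_sq⟩
  have hinv {x : TreeAut (Fin 2)} (hx : x ^ 2 = 1) (h : IsOfFinOrder (grigGen .a * x)) :
      IsOfFinOrder (x * grigGen .a) := by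
    have ha' : (grigGen .a)⁻¹ = grigGen .a :=
      inv_eq_of_mul_eq_one_left (by rw [← pow_two, grig_a_sq])
    have hx' : x⁻¹ = x := inv_eq_of_mul_eq_one_left (by rw [← pow_two, hx])
    have := h.inv
    rwa [mul_inv_rev, ha', hx'] at this
  have had : IsOfFinOrder (grigGen .a * grigGen .d) := by
    apply isOfFinOrder_grig_a_mul grig_d_apply <;>
      simpa only [sec_grig_d_zero, sec_grig_d_one, mul_one, one_mul] using hb
  have hac : IsOfFinOrder (grigGen .a * grigGen .c) := by
    apply isOfFinOrder_grig_a_mul grig_c_apply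
    · rw [sec_grig_c_zero, sec_grig_c_one]
      exact hinv grig_d_sq had
    · rwa [sec_grig_c_zero, sec_grig_c_one]
  have hab : IsOfFinOrder (grigGen .a * grigGen .b) := by
    apply isOfFinOrder_grig_a_mul grig_b_apply
    · rw [sec_grig_b_zero, sec_grig_b_one]
      exact hinv grig_c_sq hac
    · rwa [sec_grig_b_zero, sec_grig_b_one]
  rcases klein_cases β with rfl | rfl | rfl | rfl
  · exact absurd rfl hβ
  · rw [grigKlein_b]
    exact finite_closure_pair grig_a_sq grig_b_sq hab
  · rw [grigKlein_c]
    exact finite_closure_pair grig_a_sq grig_c_sq hac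
  · rw [grigKlein_d]
    exact finite_closure_pair grig_a_sq grig_d_sq had

/-! ### Finitely generated subgroups of the Grigorchuk group -/

section GrigDynamics

open RootedTree.Frame

variable {Ω : Type} [MulAction (TreeAut (Fin 2)) Ω] {y : Ω} {v₀ : Fin 2} {n : ℕ}

theorem card_C2 : (Nat.card C2).Prime := by
  rw [Nat.card_eq_fintype_card]
  decide

/-- If `w` belongs to `T` but its other rotation does not, then `w` can be left out: a walk that
enters the orbit of `w` by a `B`-step has to leave it by a `B`-step from `w`, and the two steps can
be merged. In the second part, `iB β` is the `B`-step, still to be carried out, that leads from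
`z` to `w`. -/
theorem exists_bypass {T : Set Ω} {w : Ω}
    (hw : ∀ α, grigFrame.iA α • w ∈ T → α = 1)
    (l : List (C2 ⊕ C2 × C2)) :
    (∀ z, (∀ α, grigFrame.iA α • w ≠ z) → grigFrame.Valid T z l →
      (∀ α, grigFrame.iA α • w ≠ grigFrame.ev l • z) →
      ∃ l', grigFrame.Valid (T \ {w}) z l' ∧ grigFrame.ev l' = grigFrame.ev l) ∧
    ∀ z α β, z ∈ T \ {w} → grigFrame.iB β • z = w →
      grigFrame.Valid T (grigFrame.iA α • w) l →
      (∀ α', grigFrame.iA α' • w ≠ grigFrame.ev l • grigFrame.iA α • w) →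
      ∃ l', grigFrame.Valid (T \ {w}) z l' ∧
        grigFrame.ev l' = grigFrame.ev l * grigFrame.iA α * grigFrame.iB β := by
  have hoff : ∀ z ∈ T \ {w}, ∀ α, grigFrame.iA α • w ≠ z := by
    rintro z ⟨hz, hzw⟩ α rfl
    exact hzw (by rw [hw α hz, map_one, one_smul]; rfl)
  induction l with
  | nil =>
    exact ⟨fun z _ _ _ => ⟨[], trivial, rfl⟩,
      fun z α β _ _ _ h => absurd (by simp [ev]) (h α)⟩
  | cons s l ih =>
    obtain ⟨ih1, ih2⟩ := ih
    simp only [ev_cons_smul]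
    cases s with
    | inl γ =>
      refine ⟨fun z hz hv hend => ?_, fun z α β hz hβ hv hend => ?_⟩
      · obtain ⟨l', hl', hev⟩ := ih1 _ (fun α hα => hz (γ⁻¹ * α) (by
          rw [map_mul, mul_smul, hα, map_inv, inv_smul_smul])) hv hend
        exact ⟨.inl γ :: l', hl', by rw [ev, ev, hev]⟩
      · rw [el_inl, smul_smul (grigFrame.iA γ), ← map_mul] at hend
        rw [Valid, smul_smul, ← map_mul] at hv
        obtain ⟨l', hl', hev⟩ := ih2 z (γ * α) β hz hβ hv hend
        exact ⟨l', hl', by rw [hev, ev, el_inl, map_mul]; simp only [mul_assoc]⟩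
    | inr δ =>
      refine ⟨fun z hz hv hend => ?_, fun z α β hz hβ hv hend => ?_⟩
      · obtain ⟨⟨hzT, hzT'⟩, hv⟩ := hv
        have hzw : z ∈ T \ {w} := ⟨hzT, fun h => hz 1 (by rw [map_one, one_smul, h])⟩
        by_cases hδ : grigFrame.iB δ • z = w
        · obtain ⟨l', hl', hev⟩ := ih2 z 1 δ hzw hδ
            (by rwa [map_one, one_smul, ← hδ])
            (by rw [el_inr, hδ] at hend; rwa [map_one, one_smul])
          exact ⟨l', hl', by rw [hev, ev, map_one, mul_one]; rfl⟩
        · obtain ⟨l', hl', hev⟩ := ih1 _ (hoff _ ⟨hzT', hδ⟩) hv hend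
          exact ⟨.inr δ :: l', ⟨⟨hzw, hzT', hδ⟩, hl'⟩, by rw [ev, ev, hev]⟩
      · obtain ⟨⟨hαT, hδT⟩, hv⟩ := hv
        obtain rfl := hw α hαT
        rw [map_one, one_smul] at hδT hv hend
        have hev' : grigFrame.ev (.inr δ :: l) * grigFrame.iA 1 * grigFrame.iB β =
            grigFrame.ev l * grigFrame.iB (δ * β) := by
          rw [ev, map_one, mul_one, map_mul, mul_assoc, el_inr]
        have hδβ : grigFrame.iB (δ * β) • z = grigFrame.iB δ • w := by
          rw [map_mul, mul_smul, hβ]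
        by_cases hδ : grigFrame.iB δ • w = w
        · obtain ⟨l', hl', hev⟩ := ih2 z 1 (δ * β) hz (hδβ.trans hδ)
            (by rwa [map_one, one_smul, ← hδ])
            (by rw [el_inr, hδ] at hend; rwa [map_one, one_smul])
          exact ⟨l', hl', by rw [hev, hev', map_one, mul_one]⟩
        · obtain ⟨l', hl', hev⟩ := ih1 _ (hoff _ ⟨hδT, hδ⟩) hv hend
          refine ⟨.inr (δ * β) :: l', ⟨⟨hz, ?_⟩, ?_⟩, by rw [ev, hev, hev', el_inr]⟩
          · rw [hδβ]
            exact ⟨hδT, hδ⟩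
          · rwa [hδβ]

/-- A walk that never leaves a free orbit of `A` collapses to a single `B`-step. -/
theorem exists_ev_eq_of_trapped {T : Set Ω} {w : Ω}
    (hw : ∀ α, grigFrame.iA α • w ∈ T → α = 1)
    (htrap : ∀ β, grigFrame.iB β • w ∈ T → grigFrame.iB β • w = w) {α : C2}
    {l : List (C2 ⊕ C2 × C2)} (h : grigFrame.Valid T (grigFrame.iA α • w) l) :
    ∃ γ β, grigFrame.ev l = grigFrame.iA γ * grigFrame.iB β * grigFrame.iA α⁻¹ := by
  induction l generalizing α with
  | nil => exact ⟨α, 1, by simp [ev]⟩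
  | cons s l ih =>
    cases s with
    | inl δ =>
      rw [Valid, smul_smul, ← map_mul] at h
      obtain ⟨γ, β, hev⟩ := ih h
      refine ⟨γ, β, ?_⟩
      rw [ev, hev, el_inl, mul_assoc, ← map_mul, mul_inv_rev, inv_mul_cancel_right]
    | inr δ =>
      obtain rfl := hw α h.1.1
      obtain ⟨⟨-, hδ⟩, h⟩ := h
      rw [map_one, one_smul] at hδ h
      obtain ⟨γ, β, hev⟩ := ih (α := 1) (by rwa [map_one, one_smul, ← htrap δ hδ])
      refine ⟨γ, β * δ, ?_⟩
      rw [ev, hev, el_inr, inv_one, map_one, mul_one, mul_one, map_mul, mul_assoc]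

/-- If some rotation of a point of `T` lies outside of `T`, then fewer points suffice, at least for
the stabilizer of some other point of the orbit. -/
theorem settles_of_not_invariant [MulAction.IsPretransitive (TreeAut (Fin 2)) Ω]
    (IH : grigFrame.SettlesBelow n) {T : Set Ω} (hT : T.Finite) (hn : T.ncard ≤ n)
    (hc : grigFrame.Carried y T) {w : Ω} (hwT : w ∈ T) {α₀ : C2}
    (hα₀ : grigFrame.iA α₀ • w ∉ T) :
    Settles grigFrame.group (MulAction.stabilizer (TreeAut (Fin 2)) y) := by
  have hw : ∀ α, grigFrame.iA α • w ∈ T → α = 1 := by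
    intro α hα
    have h0 : α₀ = gen2 := (C2_cases α₀).resolve_left (by
      rintro rfl
      rw [map_one, one_smul] at hα₀
      exact hα₀ hwT)
    refine (C2_cases α).resolve_right ?_
    rintro rfl
    rw [h0] at hα₀
    exact hα₀ hα
  have hfin : (T \ {w}).Finite := hT.sdiff
  have hlt : (T \ {w}).ncard < n :=
    (Set.ncard_sdiff_singleton_lt_of_mem hwT hT).trans_le hn
  by_cases hy : ∃ α, grigFrame.iA α • w = y
  · obtain ⟨α, rfl⟩ := hy
    by_cases htrap : ∀ β, grigFrame.iB β • w ∈ T → grigFrame.iB β • w = w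
    · refine Settles.of_finite ((Set.finite_range fun p : C2 × (C2 × C2) =>
        grigFrame.iA p.1 * grigFrame.iB p.2 * grigFrame.iA α⁻¹).subset fun k hk => ?_)
      obtain ⟨l, hl, rfl⟩ := hc k hk
      obtain ⟨γ, β, h⟩ := exists_ev_eq_of_trapped hw htrap hl
      exact ⟨(γ, β), h.symm⟩
    · -- Move the base point along a `B`-step out of the orbit of `w`.
      push Not at htrap
      obtain ⟨β, hβT, hβ⟩ := htrap
      set u := grigFrame.iB β • w with hu
      let q : List (C2 ⊕ C2 × C2) := [.inl α⁻¹, .inr β]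
      have hqu : grigFrame.ev q • grigFrame.iA α • w = u := by
        simp [q, ev, mul_smul, hu]
      have hq : grigFrame.Valid T (grigFrame.iA α • w) q := by
        simp only [q, Valid, map_inv, inv_smul_smul]
        exact ⟨⟨hwT, hβT⟩, trivial⟩
      have hback := grigFrame.valid_winv hq
      rw [hqu] at hback
      have hend : grigFrame.ev (winv q) • u = grigFrame.iA α • w := by
        rw [ev_winv, inv_smul_eq_iff, hqu]
      have huw : ∀ α', grigFrame.iA α' • w ≠ u := by
        intro α' h
        rw [← h] at hβT
        rw [← h, hw α' hβT, map_one, one_smul] at hβ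
        exact hβ rfl
      have hcu : grigFrame.Carried u (T \ {w}) := by
        intro k hk
        obtain ⟨l, hl, hlk⟩ := hc ((grigFrame.ev q)⁻¹ * k * grigFrame.ev q) (by
          rw [mul_smul, mul_smul, hqu, hk, ← hqu, inv_smul_smul])
        have hly : grigFrame.ev l • grigFrame.iA α • w = grigFrame.iA α • w := by
          rw [hlk, mul_smul, mul_smul, hqu, hk, ← hqu, inv_smul_smul]
        have hevk : grigFrame.ev (winv q ++ (l ++ q)) = k := by
          rw [ev_append, ev_append, hlk, ev_winv]
          group
        have hval : grigFrame.Valid T u (winv q ++ (l ++ q)) := by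
          simp only [valid_append, hend, hly]
          exact ⟨hback, hl, hq⟩
        obtain ⟨l', hl', hev⟩ := (exists_bypass hw (winv q ++ (l ++ q))).1 u huw hval
          (by rw [hevk, hk]; exact huw)
        exact ⟨l', hl', hev.trans hevk⟩
      refine Settles.of_conj (fun g hg x => grigFrame.sec_mem hg x)
        (inv_mem (grigFrame.ev_mem q)) (fun k hk => ?_) (fun k hk => ?_)
        (IH _ u _ hfin hlt hcu)
      · rw [MulAction.mem_stabilizer_iff] at hk ⊢
        rw [mul_smul, mul_smul, inv_inv, hqu, hk, ← hqu, inv_smul_smul]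
      · rw [MulAction.mem_stabilizer_iff] at hk ⊢
        rw [mul_smul, mul_smul, inv_inv, ← hqu, inv_smul_smul, hk]
  · push Not at hy
    refine IH _ y _ hfin hlt fun k hk => ?_
    obtain ⟨l, hl, rfl⟩ := hc k hk
    exact (exists_bypass hw l).1 y hy hl (by rw [hk]; exact hy)

/-- Two different points of `T` in the same orbit of the element `β` of the Klein four-group force
the stabilizer to settle. -/
def PairSettles (n : ℕ) (β : C2 × C2) : Prop :=
  ∀ (Ω : Type) [MulAction (TreeAut (Fin 2)) Ω] [MulAction.IsPretransitive (TreeAut (Fin 2)) Ω]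
    (y : Ω) (T : Set Ω), T.Finite → T.ncard ≤ n → grigFrame.Carried y T →
    ∀ w ∈ T, grigFrame.iB β • w ∈ T → grigFrame.iB β • w ≠ w →
      Settles grigFrame.group (MulAction.stabilizer (TreeAut (Fin 2)) y)

/-- The section of `d` at the letter `0` is trivial, so that `w` and `d w` have the same descendant
from the letter `0`. It is also the descendant from the letter `1` of the rotations of both points,
so that the next level needs fewer points. -/
theorem pairSettles_d (IH : grigFrame.SettlesBelow n) : PairSettles n (gen2, gen2) := by
  intro Ω _ _ y T hT hn hc w hw hdw hne
  by_cases hinv : ∀ z ∈ T, ∀ α, grigFrame.iA α • z ∈ T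
  · refine grigFrame.settles_of_rotating IH hT hn hc fun lr _ hlr hrw => ?_
    have hr := grigFrame.rotates_of_wexp_ne_one card_C2 hlr hrw
    refine grigFrame.settles_of_injOn IH hT hn hc hr fun v₀ hinj => absurd ?_ hne
    obtain ⟨z', hz'⟩ := hr.exists_lift (v₀ := v₀) 0 w
    have hd := hz'.step grigFrame (.inr (gen2, gen2))
    rw [letterSec, if_neg (by decide), el_inl, el_inr, lact,
      show grigFrame.ρ 0 (gen2, gen2) = 1 by rfl, map_one, one_smul] at hd
    have h1 := hz'.rotate grigFrame gen2
    have h2 := hd.rotate grigFrame gen2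
    exact smul_left_cancel _ (hinj (hinv _ hdw gen2) (hinv _ hw gen2)
      ((grigFrame.nextMap_eq h2).trans (grigFrame.nextMap_eq h1).symm))
  · push Not at hinv
    obtain ⟨z, hz, α, hα⟩ := hinv
    exact settles_of_not_invariant IH hT hn hc hz hα

/-- A pair of points in an orbit of `β` descends to a pair in an orbit of `σ β`. -/
theorem PairSettles.step (IH : grigFrame.SettlesBelow n) {β : C2 × C2}
    (h : PairSettles n (grigFrame.σ β)) : PairSettles n β := by
  intro Ω _ _ y T hT hn hc w hw hβw hne
  refine grigFrame.settles_of_rotating IH hT hn hc fun lr _ hlr hrw => ?_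
  have hr := grigFrame.rotates_of_wexp_ne_one card_C2 hlr hrw
  refine grigFrame.settles_of_injOn IH hT hn hc hr fun v₀ hinj => ?_
  obtain ⟨z', hz'⟩ := hr.exists_lift (v₀ := v₀) grigFrame.x₀ w
  have hβ := hz'.step grigFrame (.inr β)
  rw [letterSec, if_pos rfl, el_inr, el_inr, lact] at hβ
  refine h _ _ _ (grigFrame.finite_nextSet hT) ((grigFrame.ncard_nextSet_le hT).trans hn)
    (hc.next grigFrame) z' ⟨w, hw, hz'⟩ ⟨_, hβw, hβ⟩ fun heq => hne ?_
  exact hinj hβw hw ((grigFrame.nextMap_eq hβ).trans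
    (heq.trans (grigFrame.nextMap_eq hz').symm))

/-- The descent `b ↦ c ↦ d` of the letters at `x₀` ends with `d`. -/
theorem pairSettles (IH : grigFrame.SettlesBelow n) (β : C2 × C2) (hβ : β ≠ 1) :
    PairSettles n β := by
  have hd := pairSettles_d IH
  have hc : PairSettles n (1, gen2) := PairSettles.step IH (by exact hd)
  have hb : PairSettles n (gen2, 1) := PairSettles.step IH (by exact hc)
  rcases klein_cases β with rfl | rfl | rfl | rfl
  · exact absurd rfl hβ
  · exact hb
  · exact hc
  · exact hd

/-- A walk along which all `B`-steps are loops stays in the orbit of `A`. -/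
theorem ev_smul_of_loops {T : Set Ω} (hloop : ∀ z ∈ T, ∀ β, grigFrame.iB β • z ∈ T →
    grigFrame.iB β • z = z) {z : Ω} {l : List (C2 ⊕ C2 × C2)} (h : grigFrame.Valid T z l) :
    grigFrame.ev l • z = grigFrame.iA (wexp l) • z := by
  induction l generalizing z with
  | nil => simp [ev, wexp]
  | cons s l ih =>
    rw [ev_cons_smul]
    cases s with
    | inl α => rw [el_inl, ih h, smul_smul, ← map_mul, wexp, mul_comm]
    | inr β => rw [el_inr, ih h.2, hloop z h.1.1 β h.1.2, wexp]

/-- Once there are no pairs, all `B`-steps are loops. If the stabilizer moves the letters, it is then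
generated by `a` and a subgroup of `{1, b, c, d}`: it is finite or contains the whole group. -/
theorem grig_settlesBelow_succ (IH : grigFrame.SettlesBelow n) :
    grigFrame.SettlesBelow (n + 1) := by
  intro Ω _ _ y T hT hn' hc
  have hn : T.ncard ≤ n := Nat.lt_succ_iff.1 hn'
  by_cases hloop : ∀ z ∈ T, ∀ β, grigFrame.iB β • z ∈ T → grigFrame.iB β • z = z
  swap
  · push Not at hloop
    obtain ⟨z, hz, β, hβT, hβ⟩ := hloop
    exact pairSettles IH β (by rintro rfl; exact hβ (by rw [map_one, one_smul])) _ _ _ hT hn hc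
      z hz hβT hβ
  refine grigFrame.settles_of_rotating IH hT hn hc fun l hv hl hw => ?_
  -- The walk moves the letters and ends at the rotation of `y`, so that `y` is fixed by `a`.
  have hA : ∀ α, grigFrame.iA α • y = y := by
    have hgen : grigFrame.iA gen2 • y = y := by
      rw [ev_smul_of_loops hloop hv, (C2_cases _).resolve_left hw] at hl
      exact hl
    intro α
    rcases C2_cases α with rfl | rfl
    · rw [map_one, one_smul]
    · exact hgen
  have hmem : ∀ (L : Subgroup (TreeAut (Fin 2))), grigGen .a ∈ L →
      (∀ β, grigFrame.iB β • y = y → grigFrame.iB β ∈ L) →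
      MulAction.stabilizer (TreeAut (Fin 2)) y ≤ L := by
    intro L haL hBL k hk
    obtain ⟨l, hl, rfl⟩ := hc k hk
    clear hk
    induction l with
    | nil => exact L.one_mem
    | cons s l ih =>
      cases s with
      | inl α =>
        refine L.mul_mem (ih (by rw [← hA α]; exact hl)) ?_
        exact L.pow_mem haL _
      | inr β =>
        have hβ := hloop y hl.1.1 β hl.1.2
        exact L.mul_mem (ih (by rw [← hβ]; exact hl.2)) (hBL β hβ)
  by_cases hone : ∃ β₀, β₀ ≠ 1 ∧ ∀ β, grigFrame.iB β • y = y → β = 1 ∨ β = β₀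
  · obtain ⟨β₀, hβ₀, hall⟩ := hone
    refine Settles.of_finite ((finite_closure_grig hβ₀).subset
      (hmem _ (Subgroup.subset_closure (by simp)) fun β hβ => ?_))
    rcases hall β hβ with rfl | rfl
    · rw [map_one]
      exact one_mem _
    · exact Subgroup.subset_closure (Or.inr rfl)
  · -- Two nontrivial elements generate the Klein four-group.
    have hgen : ∀ P : C2 × C2 → Prop, P 1 → (∀ β β', P β → P β' → P (β * β')) →
        (¬ ∃ β₀, β₀ ≠ 1 ∧ ∀ β, P β → β = 1 ∨ β = β₀) → ∀ β, P β := by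
      intro P h1 hmul hno
      push Not at hno
      have key : ∀ β₁ β₂ β : C2 × C2, β₁ ≠ 1 → β₂ ≠ 1 → β₂ ≠ β₁ →
          β = 1 ∨ β = β₁ ∨ β = β₂ ∨ β = β₁ * β₂ := by
        set_option synthInstance.maxSize 1024 in
        set_option synthInstance.maxHeartbeats 200000 in decide
      obtain ⟨β₁, hP₁, h11, -⟩ := hno (gen2, 1) (by decide)
      obtain ⟨β₂, hP₂, h21, h22⟩ := hno β₁ h11
      intro β
      rcases key β₁ β₂ β h11 h21 h22 with rfl | rfl | rfl | rfl
      · exact h1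
      · exact hP₁
      · exact hP₂
      · exact hmul _ _ hP₁ hP₂
    have hB := hgen (fun β => grigFrame.iB β • y = y) (by rw [map_one, one_smul])
      (fun β β' h h' => by rw [map_mul, mul_smul, h', h]) hone
    refine Settles.of_le grig_le_secGroup (sup_le ?_ ?_)
    · rintro _ ⟨α, rfl⟩
      exact hA α
    · rintro _ ⟨β, rfl⟩
      exact hB β

theorem grigorchuk_obeysGN : ObeysGNAlternative grigorchukGroup := by
  rw [← grigFrame_group]
  exact ObeysGNAlternative.of_settles (fun g hg x => grigFrame.sec_mem hg x) fun H hH hfg =>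
    grigFrame.settles_of_fg (fun _ => grig_settlesBelow_succ) hH hfg

end GrigDynamics

end RootedTree

theorem mainTheorem7 :
    RootedTree.ObeysGNAlternative RootedTree.grigorchukGroup ∧
      RootedTree.ObeysGNAlternative RootedTree.guptaSidkiGroup :=
  ⟨RootedTree.grigorchuk_obeysGN, RootedTree.guptaSidki_obeysGN⟩
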